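/- **Setting.** Let $J(w)=\mathbb{E}\,Q(w;\boldsymbol\theta)$, $w\in\mathbb{R}^M$, where $Q(\cdot\,;\theta)$ is differentiable and $Q(w;\boldsymbol\theta)$ is integrable. Suppose that $J$ is twice differentiable with $\nu I\le\nabla^2J(w)\le\delta I$ for all $w$, where $0<\nu\le\delta$, and that $\|\nabla^2J(w_1)-\nabla^2J(w_2)\|\le\kappa\|w_1-w_2\|$ for all $w_1,w_2$. Let $w^o$ be the minimizer of $J$. Let $\boldsymbol\theta_{-1},\boldsymbol\theta_0,\boldsymbol\theta_1,\dots$ be samples with the distribution of $\boldsymbol\theta$, and write $\boldsymbol s_i(w)=\nabla_wQ(w;\boldsymbol\theta_i)-\nabla J(w)$ for the gradient noise. **Recursions.** For $\mu>0$ the standard stochastic gradient method is $$\boldsymbol x_i=\boldsymbol x_{i-1}-\mu\nabla_wQ(\boldsymbol x_{i-1};\boldsymbol\theta_i),\qquad i\ge0.$$ The momentum method has parameters $\beta_1,\beta_2\ge0$ with $\beta_1\beta_2=0$ and $\beta_1+\beta_2=\beta$, where $\beta\le1-\epsilon$ for a fixed $\epsilon>0$ (heavy-ball: $\beta_1=0$;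 Nesterov: $\beta_2=0$). It is $\boldsymbol w_{-1}=\boldsymbol w_{-2}-\mu_m\nabla_wQ(\boldsymbol w_{-2};\boldsymbol\theta_{-1})$ and, for $i\ge0$, $$\boldsymbol\psi_{i-1}=\boldsymbol w_{i-1}+\beta_1(\boldsymbol w_{i-1}-\boldsymbol w_{i-2}),\qquad \boldsymbol w_i=\boldsymbol\psi_{i-1}-\mu_m\nabla_wQ(\boldsymbol\psi_{i-1};\boldsymbol\theta_i)+\beta_2(\boldsymbol\psi_{i-1}-\boldsymbol\psi_{i-2}).$$ Both methods start from the same, possibly random, state $\boldsymbol\psi_{-2}=\boldsymbol w_{-2}=\boldsymbol x_{-1}$, which has a finite fourth moment, and $\mu=\mu_m/(1-\beta)$. **Noise.** Let $\boldsymbol{\mathcal F}_{-2}\subseteq\boldsymbol{\mathcal F}_{-1}\subseteq\boldsymbol{\mathcal F}_0\subseteq\cdots$ be a filtration such that $\boldsymbol{\mathcal F}_{i-1}$ contains the past iterates $\boldsymbol w_j,\boldsymbol x_j$, $j\le i-1$, of both methods. For all $i\ge-1$ and all $\boldsymbol{\mathcal F}_{i-1}$-measurable $\boldsymbol w$ with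 finite fourth moment suppose that $\boldsymbol s_i(\boldsymbol w)$ has a finite fourth moment and that, almost surely, $$\mathbb E[\boldsymbol s_i(\boldsymbol w)\mid\boldsymbol{\mathcal F}_{i-1}]=0,\qquad \mathbb E[\|\boldsymbol s_i(\boldsymbol w)\|^4\mid\boldsymbol{\mathcal F}_{i-1}]\le\gamma_4^4\|w^o-\boldsymbol w\|^4+\sigma_{s,4}^4 .$$ Let $\gamma,\sigma_s\ge0$ be constants of the resulting second-moment bound $\mathbb E[\|\boldsymbol s_i(\boldsymbol w)\|^2\mid\boldsymbol{\mathcal F}_{i-1}]\le\gamma^2\|w^o-\boldsymbol w\|^2+\sigma_s^2$ (for instance $\gamma=\gamma_4$, $\sigma_s=\sigma_{s,4}$). Suppose also that, for all $i\ge0$, $$\mathbb E[\|\boldsymbol s_i(\boldsymbol\psi_{i-1})-\boldsymbol s_i(\boldsymbol x_{i-1})\|^2\mid\boldsymbol{\mathcal F}_{i-1}]\le\xi_1\|\boldsymbol\psi_{i-1}-\boldsymbol x_{i-1}\|^2,\qquad \mathbb E[\|\boldsymbol s_i(\boldsymbol\psi_{i-1})-\boldsymbol s_i(\boldsymbol x_{i-1})\|^4\mid\boldsymbol{\mathcal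 F}_{i-1}]\le\xi_2\|\boldsymbol\psi_{i-1}-\boldsymbol x_{i-1}\|^4 .$$ **Theorem.** There are constants $C,\mu_0>0$, depending only on $\nu,\delta,\kappa,\gamma,\sigma_s,\gamma_4,\sigma_{s,4},\xi_1,\xi_2,\epsilon$ and a bound on $\mathbb E\|w^o-\boldsymbol w_{-2}\|^4$, such that the following holds whenever $0<\mu<\mu_0$. Put $\rho_1=1-\mu\nu/2$ and $\tau_2=\sqrt{1-\mu\nu/4}$. Then $\rho_1,\tau_2\in(0,1)$, and for every $i\ge0$ the expectation $\mathbb E\|\boldsymbol w_i-\boldsymbol x_i\|^2$ is finite and $$\mathbb E\|\boldsymbol w_i-\boldsymbol x_i\|^2\le C\left(\frac{\delta^2\sigma_s^2\,i^2\,\tau_2^{\,i+1}\mu^{3/2}}{(1-\beta)\nu^{5/2}}+\left[\frac{(\delta^2+\gamma^2)\rho_1^{\,i+1}}{(1-\beta)^2}+\frac{\delta^2\sigma_s^4}{(1-\beta)\nu^2}\right]\mu^2\right),\qquad \mathbb E\|\boldsymbol w_i-\boldsymbol x_i\|^2\le C\mu^{3/2}.$$ Moreover $$\limsup_{i\to\infty}\mathbb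 E\|\boldsymbol w_i-\boldsymbol x_i\|^2\le C\,\frac{\delta^2\sigma_s^4\mu^2}{(1-\beta)\nu^2}\qquad\text{and}\qquad \limsup_{i\to\infty}\mathbb E\|\boldsymbol w_i-\boldsymbol x_i\|^2\le C\mu^2 .$$ -/

import Mathlib

open MeasureTheory ProbabilityTheory Filter

namespace MomentumSGD

/-- The parameter space `ℝ^M` with its Euclidean norm. -/
abbrev Vec (M : ℕ) : Type := EuclideanSpace ℝ (Fin M)

/-! ### Risk function -/

section Risk

variable {M : ℕ} {Θ : Type*} [MeasurableSpace Θ]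

/-- The risk `J(w) = E[Q(w; θ)]`, where `P` is the distribution of `θ`. -/
noncomputable def risk (Q : Vec M → Θ → ℝ) (P : Measure Θ) (w : Vec M) : ℝ :=
  ∫ t, Q w t ∂P

/-- The Hessian of `J` at `w`, as a linear operator. -/
noncomputable def hessian (J : Vec M → ℝ) (w : Vec M) : Vec M →L[ℝ] Vec M :=
  fderiv ℝ (gradient J) w

/-- `J` is twice differentiable and `ν I ≤ ∇²J(w) ≤ δ I` for every `w`. -/
structure RiskCondition (J : Vec M → ℝ) (ν δ : ℝ) : Prop where
  differentiable : Differentiable ℝ J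
  differentiable_gradient : Differentiable ℝ (gradient J)
  lower : ∀ w v : Vec M, ν * ‖v‖ ^ 2 ≤ inner ℝ v (hessian J w v)
  upper : ∀ w v : Vec M, inner ℝ v (hessian J w v) ≤ δ * ‖v‖ ^ 2

/-- The Hessian of `J` is `κ`-Lipschitz in the operator norm. -/
def HessianLipschitz (J : Vec M → ℝ) (κ : ℝ) : Prop :=
  ∀ w₁ w₂ : Vec M, ‖hessian J w₁ - hessian J w₂‖ ≤ κ * ‖w₁ - w₂‖

/-- The gradient of the loss in its first argument, `∇_w Q(w; t)`. -/
noncomputable def lossGrad (Q : Vec M → Θ → ℝ) (w : Vec M) (t : Θ) : Vec M :=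
  gradient (fun v => Q v t) w

/-- The gradient noise `∇_w Q(w; t) - ∇ J(w)` at the point `w` for the sample value `t`. -/
noncomputable def gradNoise (Q : Vec M → Θ → ℝ) (P : Measure Θ) (w : Vec M) (t : Θ) : Vec M :=
  lossGrad Q w t - gradient (risk Q P) w

end Risk

/-! ### The two recursions

Samples are indexed by `k = 0, 1, 2, …`, where sample `k` is `θ_{k-1}`.  The iterates below are
shifted in the same way, so that every index is a natural number:
`sgd … n = x_{n-1}`, `momentumIter … n = w_{n-2}` and `momentumExtrap … n = ψ_{n-2}`. -/

section Recursions

variable {M : ℕ} {Θ : Type*}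

/-- Standard stochastic gradient: `x_{-1} = w₀`, `x_i = x_{i-1} - μ ∇Q(x_{i-1}; θ_i)`. -/
noncomputable def sgd (Q : Vec M → Θ → ℝ) (μ : ℝ) (w₀ : Vec M) (t : ℕ → Θ) : ℕ → Vec M
  | 0 => w₀
  | n + 1 => sgd Q μ w₀ t n - μ • lossGrad Q (sgd Q μ w₀ t n) (t (n + 1))

/-- The triple `(w_{n-2}, ψ_{n-2}, w_{n-1})` of the momentum stochastic gradient method. -/
noncomputable def momentumState (Q : Vec M → Θ → ℝ) (μm β₁ β₂ : ℝ) (w₀ : Vec M) (t : ℕ → Θ) :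
    ℕ → Vec M × Vec M × Vec M
  | 0 => (w₀, w₀, w₀ - μm • lossGrad Q w₀ (t 0))
  | n + 1 =>
    let w := (momentumState Q μm β₁ β₂ w₀ t n).1
    let ψ := (momentumState Q μm β₁ β₂ w₀ t n).2.1
    let w' := (momentumState Q μm β₁ β₂ w₀ t n).2.2
    let ψ' := w' + β₁ • (w' - w)
    (w', ψ', ψ' - μm • lossGrad Q ψ' (t (n + 1)) + β₂ • (ψ' - ψ))

/-- The momentum iterate `w_{n-2}`. -/
noncomputable def momentumIter (Q : Vec M → Θ → ℝ) (μm β₁ β₂ : ℝ) (w₀ : Vec M) (t : ℕ → Θ)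
    (n : ℕ) : Vec M :=
  (momentumState Q μm β₁ β₂ w₀ t n).1

/-- The momentum extrapolation point `ψ_{n-2}`. -/
noncomputable def momentumExtrap (Q : Vec M → Θ → ℝ) (μm β₁ β₂ : ℝ) (w₀ : Vec M) (t : ℕ → Θ)
    (n : ℕ) : Vec M :=
  (momentumState Q μm β₁ β₂ w₀ t n).2.1

variable (Q : Vec M → Θ → ℝ) (μm β₁ β₂ : ℝ) (w₀ : Vec M) (t : ℕ → Θ)

/-- `w_{-2}` is the initial state. -/
theorem momentumIter_zero : momentumIter Q μm β₁ β₂ w₀ t 0 = w₀ := rfl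

/-- `ψ_{-2}` is the initial state. -/
theorem momentumExtrap_zero : momentumExtrap Q μm β₁ β₂ w₀ t 0 = w₀ := rfl

/-- `w_{-1} = w_{-2} - μ_m ∇Q(w_{-2}; θ_{-1})`. -/
theorem momentumIter_one :
    momentumIter Q μm β₁ β₂ w₀ t 1 = w₀ - μm • lossGrad Q w₀ (t 0) := rfl

/-- `ψ_{i-1} = w_{i-1} + β₁ (w_{i-1} - w_{i-2})`. -/
theorem momentumExtrap_succ (i : ℕ) :
    momentumExtrap Q μm β₁ β₂ w₀ t (i + 1) =
      momentumIter Q μm β₁ β₂ w₀ t (i + 1) +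
        β₁ • (momentumIter Q μm β₁ β₂ w₀ t (i + 1) - momentumIter Q μm β₁ β₂ w₀ t i) := rfl

/-- `w_i = ψ_{i-1} - μ_m ∇Q(ψ_{i-1}; θ_i) + β₂ (ψ_{i-1} - ψ_{i-2})`. -/
theorem momentumIter_succ_succ (i : ℕ) :
    momentumIter Q μm β₁ β₂ w₀ t (i + 2) =
      momentumExtrap Q μm β₁ β₂ w₀ t (i + 1)
        - μm • lossGrad Q (momentumExtrap Q μm β₁ β₂ w₀ t (i + 1)) (t (i + 1))
        + β₂ • (momentumExtrap Q μm β₁ β₂ w₀ t (i + 1)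
            - momentumExtrap Q μm β₁ β₂ w₀ t i) := rfl

end Recursions

/-! ### Conditions on the gradient noise

`ℱ k` is the collection of past history before sample `k` is drawn.  Conditions that hold for
every `ℱ k`-measurable `w` are stated for those with finite fourth moment, where all conditional
expectations are those of integrable variables. -/

section Noise

variable {M : ℕ} {Θ Ω : Type*} [MeasurableSpace Θ] {mΩ : MeasurableSpace Ω}

/-- `w` is measurable with respect to the past `m` and has finite fourth moment. -/
def PastVec (Pr : Measure Ω) (m : MeasurableSpace Ω) (w : Ω → Vec M) : Prop :=
  Measurable[m] w ∧ MemLp w 4 Pr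

/-- First- and fourth-moment conditions: `E[s(w) | ℱ] = 0` and
`E[‖s(w)‖⁴ | ℱ] ≤ γ₄⁴ ‖wᵒ - w‖⁴ + σ₄⁴`. -/
structure NoiseFourth (Q : Vec M → Θ → ℝ) (P : Measure Θ) (wo : Vec M) (Pr : Measure Ω)
    (ℱ : Filtration ℕ mΩ) (θ : ℕ → Ω → Θ) (γ₄ σ₄ : ℝ) : Prop where
  memLp : ∀ (k : ℕ) (w : Ω → Vec M), PastVec Pr (ℱ k) w →
    MemLp (fun ω => gradNoise Q P (w ω) (θ k ω)) 4 Pr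
  mean_zero : ∀ (k : ℕ) (w : Ω → Vec M), PastVec Pr (ℱ k) w →
    Pr[fun ω => gradNoise Q P (w ω) (θ k ω) | ℱ k] =ᵐ[Pr] 0
  fourth : ∀ (k : ℕ) (w : Ω → Vec M), PastVec Pr (ℱ k) w →
    Pr[fun ω => ‖gradNoise Q P (w ω) (θ k ω)‖ ^ 4 | ℱ k] ≤ᵐ[Pr]
      fun ω => γ₄ ^ 4 * ‖wo - w ω‖ ^ 4 + σ₄ ^ 4

/-- `γ` and `σ` are constants of the second-moment bound
`E[‖s(w)‖² | ℱ] ≤ γ² ‖wᵒ - w‖² + σ²`.  Under `NoiseFourth` it always holds with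
`γ = γ₄` and `σ = σ₄`. -/
def NoiseSecond (Q : Vec M → Θ → ℝ) (P : Measure Θ) (wo : Vec M) (Pr : Measure Ω)
    (ℱ : Filtration ℕ mΩ) (θ : ℕ → Ω → Θ) (γ σ : ℝ) : Prop :=
  ∀ (k : ℕ) (w : Ω → Vec M), PastVec Pr (ℱ k) w →
    Pr[fun ω => ‖gradNoise Q P (w ω) (θ k ω)‖ ^ 2 | ℱ k] ≤ᵐ[Pr]
      fun ω => γ ^ 2 * ‖wo - w ω‖ ^ 2 + σ ^ 2

/-- Noise-difference condition along `ψ_{i-1} = ψ (i + 1)` and `x_{i-1} = x i`, for the sample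
`θ_i = θ (i + 1)`, given the past of that sample, with exponent `p` and constant `ξ`:
`E[‖s_i(ψ_{i-1}) - s_i(x_{i-1})‖^p | ℱ] ≤ ξ ‖ψ_{i-1} - x_{i-1}‖^p` for all `i ≥ 0`. -/
def NoiseLipschitz (Q : Vec M → Θ → ℝ) (P : Measure Θ) (Pr : Measure Ω)
    (ℱ : Filtration ℕ mΩ) (θ : ℕ → Ω → Θ) (ψ x : ℕ → Ω → Vec M) (p : ℕ) (ξ : ℝ) : Prop :=
  ∀ i : ℕ,
    Pr[fun ω => ‖gradNoise Q P (ψ (i + 1) ω) (θ (i + 1) ω)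
        - gradNoise Q P (x i ω) (θ (i + 1) ω)‖ ^ p | ℱ (i + 1)] ≤ᵐ[Pr]
      fun ω => ξ * ‖ψ (i + 1) ω - x i ω‖ ^ p

end Noise

end MomentumSGD

open MomentumSGD

universe u v

/-! With `D = w' - w` the increment and `V = w' + β/(1-β) • D`, momentum cancels from the recursion
of `V`. With `g = ∇J` and noise `S` at `ψ`, `V` moves by `-μ (g ψ + S)`, a plain stochastic gradient
step except that the gradient is taken at `ψ = V - c D`, while `D' = β D - (1-β) μ (g ψ + S)`. Three
mean squares then close on each other (`mean_square_step`): `a = E‖V - wo‖²` contracts at rate `μν`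
and stays bounded; `b = E‖D‖²` contracts at rate `1 - β ≥ ε` under a forcing of order `μ²`, so `b =
O(μ²)`; `z = E‖V - x‖²` contracts at rate `μν` under a forcing `μ b = O(μ³)`, so `z = O(μ²)`. The
two methods share their samples, so only the difference of their noises enters `z`; it is controlled
by `‖ψ - x‖`, and no `μ²σ²` term appears. Since `w' - x = (V - x) - β/(1-β) • D`, the squared
distance is `O(μ² (ρ₁^i + σ²))`. `exists_bound_of_coupled_recursion` solves the recursions,
`exists_mean_square_distance_le` applies it, and `le_of_le_geometric_add_noise` converts the result
into the stated bounds. -/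

namespace MomentumSGD

/-! ### Lipschitz continuity and strong monotonicity of the gradient. -/

section Analysis

variable {M : ℕ} {J : Vec M → ℝ} {ν δ : ℝ}

/-- The Hessian of a twice differentiable function is symmetric. -/
theorem RiskCondition.hessian_symm (h : RiskCondition J ν δ) (w u v : Vec M) :
    inner ℝ u (hessian J w v) = inner ℝ v (hessian J w u) := by
  have hJ : ∀ y, HasFDerivAt J (innerSL ℝ (gradient J y)) y := fun y => by
    have := (h.differentiable y).hasGradientAt.hasFDerivAt
    exact this
  have hg : HasFDerivAt (fun y => innerSL ℝ (gradient J y))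
      ((innerSL ℝ : Vec M →L[ℝ] Vec M →L[ℝ] ℝ).comp (hessian J w)) w :=
    (innerSL ℝ : Vec M →L[ℝ] Vec M →L[ℝ] ℝ).hasFDerivAt.comp w
      (h.differentiable_gradient w).hasFDerivAt
  have := second_derivative_symmetric hJ hg v u
  simp only [ContinuousLinearMap.comp_apply, innerSL_apply_apply] at this
  rw [real_inner_comm, this, real_inner_comm]

/-- The hypotheses bound only the quadratic form; symmetry and polarization turn this into an
operator norm bound. -/
theorem RiskCondition.norm_hessian_le (h : RiskCondition J ν δ) (hν : 0 ≤ ν) (hδ : 0 ≤ δ)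
    (w : Vec M) : ‖hessian J w‖ ≤ δ := by
  refine ContinuousLinearMap.opNorm_le_bound _ hδ fun v => ?_
  set H := hessian J w
  have key : ∀ a b : Vec M, 4 * inner ℝ a (H b) ≤ δ * ‖a + b‖ ^ 2 := by
    intro a b
    have h1 := h.upper w (a + b)
    have h2 := h.lower w (a - b)
    have h3 := h.hessian_symm w a b
    simp only [map_add, map_sub, inner_add_left, inner_add_right, inner_sub_left,
      inner_sub_right] at h1 h2
    have h4 : 0 ≤ ν * ‖a - b‖ ^ 2 := by positivity
    change inner ℝ a (H b) = inner ℝ b (H a) at h3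
    change inner ℝ a (H a) + inner ℝ b (H a) + (inner ℝ a (H b) + inner ℝ b (H b)) ≤ _ at h1
    change _ ≤ inner ℝ a (H a) - inner ℝ b (H a) - (inner ℝ a (H b) - inner ℝ b (H b)) at h2
    linarith
  rcases eq_or_ne (H v) 0 with h0 | h0
  · rw [h0, norm_zero]; positivity
  rcases eq_or_ne v 0 with hv | hv
  · rw [hv, map_zero, norm_zero]; simp
  have hu : 0 < ‖H v‖ := norm_pos_iff.2 h0
  have hv' : 0 < ‖v‖ := norm_pos_iff.2 hv
  -- The two test vectors have the same norm `‖v‖ ‖H v‖`, which makes the polarized bound sharp.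
  have h1 := key (‖v‖ • H v) (‖H v‖ • v)
  have h2 : ‖‖v‖ • H v + ‖H v‖ • v‖ ≤ 2 * (‖H v‖ * ‖v‖) := by
    refine (norm_add_le _ _).trans (le_of_eq ?_)
    rw [norm_smul, norm_smul, norm_norm, norm_norm]; ring
  have h3 : ‖‖v‖ • H v + ‖H v‖ • v‖ ^ 2 ≤ (2 * (‖H v‖ * ‖v‖)) ^ 2 := by gcongr
  rw [map_smul, real_inner_smul_left, real_inner_smul_right, real_inner_self_eq_norm_sq] at h1
  have h4 := h1.trans (mul_le_mul_of_nonneg_left h3 hδ)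
  have h5 : 0 < ‖v‖ * ‖H v‖ ^ 2 := by positivity
  refine le_of_mul_le_mul_left ?_ h5
  nlinarith

theorem RiskCondition.norm_gradient_sub_le (h : RiskCondition J ν δ) (hν : 0 ≤ ν) (hδ : 0 ≤ δ)
    (y z : Vec M) : ‖gradient J y - gradient J z‖ ≤ δ * ‖y - z‖ :=
  convex_univ.norm_image_sub_le_of_norm_fderiv_le (fun w _ => h.differentiable_gradient w)
    (fun w _ => h.norm_hessian_le hν hδ w) (Set.mem_univ z) (Set.mem_univ y)

/-- The mean value theorem on the segment from `z` to `y` replaces an integral of the Hessian, so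
the Hessian need not be continuous. -/
theorem RiskCondition.strongly_monotone (h : RiskCondition J ν δ) (y z : Vec M) :
    ν * ‖y - z‖ ^ 2 ≤ inner ℝ (y - z) (gradient J y - gradient J z) := by
  have hd : ∀ t : ℝ, HasDerivAt (fun t : ℝ => inner ℝ (y - z) (gradient J (z + t • (y - z))))
      (inner ℝ (y - z) (hessian J (z + t • (y - z)) (y - z))) t := by
    intro t
    have h1 : HasDerivAt (fun t : ℝ => z + t • (y - z)) (y - z) t := by
      simpa using ((hasDerivAt_id t).smul_const (y - z)).const_add z
    have h2 := (h.differentiable_gradient (z + t • (y - z))).hasFDerivAt.comp_hasDerivAt t h1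
    have h3 := (innerSL ℝ (y - z)).hasFDerivAt.comp_hasDerivAt t h2
    exact h3
  obtain ⟨t, -, ht⟩ := exists_hasDerivAt_eq_slope
    (fun t : ℝ => inner ℝ (y - z) (gradient J (z + t • (y - z)))) _ zero_lt_one
    (fun t _ => (hd t).continuousAt.continuousWithinAt) (fun t _ => hd t)
  have h1 := h.lower (z + t • (y - z)) (y - z)
  rw [ht] at h1
  simpa [inner_sub_right] using h1

theorem gradient_eq_zero_of_forall_le {wo : Vec M} (h : ∀ v, J wo ≤ J v) : gradient J wo = 0 := by
  have h1 : IsLocalMin J wo := Eventually.of_forall h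
  rw [gradient, h1.fderiv_eq_zero, map_zero]

end Analysis

/-! ### Deterministic one-step inequalities. -/

section InnerProduct

variable {E : Type*} [NormedAddCommGroup E] [InnerProductSpace ℝ E]

theorem norm_add_sq_le_two (a b : E) : ‖a + b‖ ^ 2 ≤ 2 * ‖a‖ ^ 2 + 2 * ‖b‖ ^ 2 := by
  have := parallelogram_law_with_norm ℝ a b
  nlinarith [sq_nonneg ‖a - b‖]

theorem norm_sub_sq_le_two (a b : E) : ‖a - b‖ ^ 2 ≤ 2 * ‖a‖ ^ 2 + 2 * ‖b‖ ^ 2 := by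
  simpa [sub_eq_add_neg] using norm_add_sq_le_two a (-b)

/-- Convexity of the squared norm, in the form used for an exponentially weighted sum. -/
theorem norm_smul_sub_sq_le {β : ℝ} (hβ : 0 ≤ β) (hβ1 : β < 1) (a b : E) :
    ‖β • a - b‖ ^ 2 ≤ β * ‖a‖ ^ 2 + ‖b‖ ^ 2 / (1 - β) := by
  have h1 : 0 < 1 - β := by linarith
  -- The gap between the two sides of the goal is `β / (1 - β)` times this square.
  have h2 : 0 ≤ ‖(1 - β) • a + b‖ ^ 2 := by positivity
  rw [norm_add_sq_real, norm_smul, real_inner_smul_left, Real.norm_of_nonneg h1.le] at h2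
  rw [norm_sub_sq_real, norm_smul, real_inner_smul_left, Real.norm_of_nonneg hβ]
  have h3 : β * ‖a‖ ^ 2 + ‖b‖ ^ 2 / (1 - β) - ((β * ‖a‖) ^ 2 - 2 * (β * inner ℝ a b) + ‖b‖ ^ 2)
      = β / (1 - β) * (((1 - β) * ‖a‖) ^ 2 + 2 * ((1 - β) * inner ℝ a b) + ‖b‖ ^ 2) := by
    field_simp; ring
  have h4 := mul_nonneg (div_nonneg hβ h1.le) h2
  linarith

/-- One gradient step, with the gradient evaluated at `y` instead of `p`, contracts the distance
of `p` to `q` up to a multiple of `‖p - y‖ ^ 2`. -/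
theorem gradient_step_contraction {g : E → E} {ν δ μ : ℝ} (hν : 0 < ν) (hμ : 0 ≤ μ)
    (hmono : ∀ y z, ν * ‖y - z‖ ^ 2 ≤ inner ℝ (y - z) (g y - g z))
    (hlip : ∀ y z, ‖g y - g z‖ ≤ δ * ‖y - z‖) (p q y : E) :
    ‖(p - q) - μ • (g y - g q)‖ ^ 2 ≤ (1 - μ * ν + 2 * μ ^ 2 * δ ^ 2) * ‖p - q‖ ^ 2
      + (μ * δ ^ 2 / ν + 2 * μ ^ 2 * δ ^ 2) * ‖p - y‖ ^ 2 := by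
  have h1 : inner ℝ (p - q) (g y - g q)
      = inner ℝ (p - q) (g p - g q) - inner ℝ (p - q) (g p - g y) := by
    rw [← inner_sub_right]; congr 1; abel
  have h2 := hmono p q
  have h3 : inner ℝ (p - q) (g p - g y) ≤ ‖p - q‖ * (δ * ‖p - y‖) :=
    (real_inner_le_norm _ _).trans (mul_le_mul_of_nonneg_left (hlip _ _) (norm_nonneg _))
  -- Young's inequality, weighted so that the misplaced gradient costs half of the `2ν` supplied by
  -- monotonicity.
  have h4 : 2 * (‖p - q‖ * (δ * ‖p - y‖)) ≤ ν * ‖p - q‖ ^ 2 + δ ^ 2 / ν * ‖p - y‖ ^ 2 := by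
    have h5 : 0 ≤ (ν * ‖p - q‖ - δ * ‖p - y‖) ^ 2 / ν := by positivity
    have h6 : (ν * ‖p - q‖ - δ * ‖p - y‖) ^ 2 / ν = ν * ‖p - q‖ ^ 2 + δ ^ 2 / ν * ‖p - y‖ ^ 2
        - 2 * (‖p - q‖ * (δ * ‖p - y‖)) := by field_simp; ring
    linarith
  have h7 : ‖g y - g q‖ ^ 2 ≤ δ ^ 2 * (2 * ‖p - q‖ ^ 2 + 2 * ‖p - y‖ ^ 2) := by
    calc ‖g y - g q‖ ^ 2 ≤ (δ * ‖y - q‖) ^ 2 := by gcongr; exact hlip _ _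
      _ = δ ^ 2 * ‖(p - q) - (p - y)‖ ^ 2 := by
        rw [mul_pow, sub_sub_sub_cancel_left]
      _ ≤ _ := by gcongr; exact norm_sub_sq_le_two _ _
  rw [norm_sub_sq_real, norm_smul, real_inner_smul_right, Real.norm_of_nonneg hμ, h1, mul_pow]
  have h8 := mul_le_mul_of_nonneg_left h7 (sq_nonneg μ)
  have h9 := mul_le_mul_of_nonneg_left
    (show 2 * (ν * ‖p - q‖ ^ 2) - (ν * ‖p - q‖ ^ 2 + δ ^ 2 / ν * ‖p - y‖ ^ 2) ≤
      2 * (inner ℝ (p - q) (g p - g q) - inner ℝ (p - q) (g p - g y)) by linarith) hμ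
  have h10 : μ * δ ^ 2 / ν = μ * (δ ^ 2 / ν) := by ring
  rw [h10]
  linarith

end InnerProduct

/-! ### Solving the coupled scalar recursions. -/

section Recursion

/-- Induction step for an error sequence with a small feedback from a second sequence. -/
theorem affine_step_le {c d ρ A B r e e' x x' y : ℝ} (hc : 0 ≤ c) (hd : 0 ≤ d) (hA : 0 ≤ A)
    (he : 0 ≤ e) (hee : ρ * e ≤ e') (hx : x ≤ A * e) (hy : y ≤ B * e)
    (hr : x' ≤ c * x + d * y + r * e) (h : c * A + d * B + r ≤ ρ * A) : x' ≤ A * e' := by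
  have h1 := mul_le_mul_of_nonneg_left hx hc
  have h2 := mul_le_mul_of_nonneg_left hy hd
  have h3 := mul_le_mul_of_nonneg_right h he
  have h4 := mul_le_mul_of_nonneg_left hee hA
  linarith

/-- Three coupled mean-square recursions: the squared error `a` of the momentum-free combination,
the squared increment `b`, and the squared distance `z` to the momentum-free method. -/
theorem exists_bound_of_coupled_recursion {ν ε K A₀ : ℝ} (hν : 0 < ν) (hε : 0 < ε) (hε1 : ε ≤ 1)
    (hK : 0 ≤ K) (hA₀ : 0 ≤ A₀) :
    ∃ C μ₀ : ℝ, 0 < C ∧ 0 < μ₀ ∧ ∀ (μ s : ℝ) (a b z : ℕ → ℝ), 0 < μ → μ < μ₀ → 0 ≤ s →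
      (∀ i, 0 ≤ a i) → (∀ i, 0 ≤ b i) → (∀ i, 0 ≤ z i) →
      a 0 ≤ A₀ → b 0 ≤ A₀ * μ ^ 2 → z 0 ≤ A₀ * μ ^ 2 →
      (∀ i, a (i + 1) ≤ (1 - μ * ν + K * μ ^ 2) * a i + K * μ * b i + μ ^ 2 * s) →
      (∀ i, b (i + 1) ≤ (1 - ε) * b i + K * μ ^ 2 * (a i + b i + s)) →
      (∀ i, z (i + 1) ≤ (1 - μ * ν + K * μ ^ 2) * z i + K * μ * b i) →
      ∀ i, b i ≤ C * μ ^ 2 * ((1 - μ * ν / 2) ^ i + s) ∧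
        z i ≤ C * μ ^ 2 * ((1 - μ * ν / 2) ^ i + s) := by
  -- The constants follow the coupling: half of `ε B` pays for the forcing `K (A + 1)` of `b`, and a
  -- quarter of `ν Z` pays for the forcing `K B` of `z`. The `+ 1` keeps `A`, and so the step-size
  -- threshold, positive.
  set A := A₀ + 1 with hA
  set B := 2 * K * (A + 1) / ε + A₀ with hB
  set Z := 4 * K * B / ν + A₀ with hZ
  have hA1 : 1 ≤ A := by linarith
  have hB0 : 0 ≤ B := by positivity
  have hZ0 : 0 ≤ Z := by positivity
  have hBε : 2 * K * (A + 1) ≤ ε * B := by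
    have : ε * B = 2 * K * (A + 1) + ε * A₀ := by rw [hB]; field_simp
    linarith only [this, mul_nonneg hε.le hA₀]
  have hZν : 4 * K * B ≤ ν * Z := by
    have : ν * Z = 4 * K * B + ν * A₀ := by rw [hZ]; field_simp
    linarith only [this, mul_nonneg hν.le hA₀]
  have hAB : A₀ ≤ B := by
    have : 0 ≤ 2 * K * (A + 1) / ε := by positivity
    linarith
  have hAZ : A₀ ≤ Z := by
    have : 0 ≤ 4 * K * B / ν := by positivity
    linarith
  set R := K * A + K * B + 1 with hR
  have hR0 : 0 < R := by positivity
  set μ₀ := min (min 1 (1 / ν)) (min (ν * A / (2 * R))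
    (min (ε / (2 * (K + ν / 2))) (ν / (4 * (K + 1))))) with hμ₀
  have hKν : 0 < K + ν / 2 := by positivity
  refine ⟨B + Z + 1, μ₀, by positivity, by positivity, ?_⟩
  intro μ s a b z hμ hμlt hs ha hb hz ha0 hb0 hz0 hra hrb hrz
  simp only [hμ₀, lt_min_iff] at hμlt
  obtain ⟨⟨hl1, hl2⟩, hl3, hl4, hl5⟩ := hμlt
  rw [lt_div_iff₀ hν] at hl2
  rw [lt_div_iff₀ (by positivity)] at hl3 hl4 hl5
  have hρ : 0 ≤ 1 - μ * ν / 2 := by linarith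
  -- Common envelope: it loses at most the factor `1 - μν/2` per step and dominates `s`. Its rate is
  -- half of the available contraction `μν`; the other half absorbs the perturbations.
  set e : ℕ → ℝ := fun i => (1 - μ * ν / 2) ^ i + s with he
  have he0 : ∀ i, 0 ≤ e i := fun i => by positivity
  have hse : ∀ i, s ≤ e i := fun i => by
    have : 0 ≤ (1 - μ * ν / 2) ^ i := by positivity
    simp only [he]; linarith
  have hee : ∀ i, (1 - μ * ν / 2) * e i ≤ e (i + 1) := fun i => by
    simp only [he, pow_succ]
    linarith only [mul_nonneg (mul_nonneg hμ.le hν.le) hs]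
  have he00 : 1 ≤ e 0 := by simp [he, hs]
  have hμ2 : 0 ≤ μ ^ 2 := by positivity
  have hμ2μ : μ ^ 2 ≤ μ := by nlinarith only [hμ, hl1]
  have main : ∀ i, a i ≤ A * e i ∧ b i ≤ B * μ ^ 2 * e i ∧ z i ≤ Z * μ ^ 2 * e i := by
    intro i
    induction i with
    | zero =>
      refine ⟨?_, ?_, ?_⟩
      · exact (by linarith only [ha0, hA] : a 0 ≤ A).trans (le_mul_of_one_le_right (by linarith) he00)
      · refine hb0.trans ?_
        exact (mul_le_mul_of_nonneg_right hAB hμ2).trans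
          (le_mul_of_one_le_right (mul_nonneg hB0 hμ2) he00)
      · refine hz0.trans ?_
        exact (mul_le_mul_of_nonneg_right hAZ hμ2).trans
          (le_mul_of_one_le_right (mul_nonneg hZ0 hμ2) he00)
    | succ i ih =>
      obtain ⟨iha, ihb, ihz⟩ := ih
      have hc : 0 ≤ 1 - μ * ν + K * μ ^ 2 := by
        linarith only [hl2, mul_nonneg hK hμ2]
      have hei := he0 i
      have hsi := hse i
      have hε' : 0 ≤ 1 - ε := by linarith
      have hKμ : 0 ≤ K * μ := by positivity
      have hKμ2 : 0 ≤ K * μ ^ 2 := by positivity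
      have hsm : μ ^ 2 * s ≤ μ ^ 2 * e i := mul_le_mul_of_nonneg_left hsi hμ2
      refine ⟨?_, ?_, ?_⟩
      · refine affine_step_le (r := μ ^ 2) hc hKμ (by linarith) hei (hee i) iha ihb ?_ ?_
        · linarith only [hra i, hsm]
        · have h3 : K * μ * (B * μ ^ 2) ≤ K * μ * (B * μ) := by gcongr
          have h4 := mul_le_mul_of_nonneg_left hl3.le hμ.le
          rw [hR] at h4
          linarith only [h3, h4]
      · refine affine_step_le (c := 1 - ε + K * μ ^ 2) (d := K * μ ^ 2) (r := K * μ ^ 2)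
          (by linarith) hKμ2 (by positivity) hei (hee i) ihb iha ?_ ?_
        · have h3 := mul_le_mul_of_nonneg_left hsi hKμ2
          linarith only [hrb i, h3]
        · have h3 : K * (B * μ ^ 2) ≤ K * (B * μ) := by gcongr
          have h4 := mul_le_mul_of_nonneg_right hl4.le hB0
          have h2 : K * (A + 1) + K * (B * μ ^ 2) ≤ (ε - μ * ν / 2) * B := by
            linarith only [h3, h4, hBε]
          have h5 := mul_le_mul_of_nonneg_left h2 hμ2
          linarith only [h5]
      -- `z` has no noise forcing of its own, hence `r = 0`.
      · refine affine_step_le (r := 0) hc hKμ (by positivity) hei (hee i) ihz ihb ?_ ?_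
        · linarith only [hrz i]
        · have h4 := mul_le_mul_of_nonneg_left hl5.le (mul_nonneg hμ.le hZ0)
          have h5 := mul_le_mul_of_nonneg_left hZν hμ.le
          have h6 := mul_nonneg (mul_nonneg hμ.le hμ.le) hZ0
          have h2 : K * μ ^ 2 * Z + K * μ * B ≤ μ * ν / 2 * Z := by
            linarith only [h4, h5, h6]
          have h7 := mul_le_mul_of_nonneg_left h2 hμ2
          linarith only [h7]
  intro i
  obtain ⟨-, h1, h2⟩ := main i
  have h3 := mul_nonneg hμ2 (he0 i)
  constructor
  · refine h1.trans ?_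
    show _ ≤ (B + Z + 1) * μ ^ 2 * e i
    nlinarith only [h3, hB0, hZ0, mul_nonneg hB0 h3, mul_nonneg hZ0 h3]
  · refine h2.trans ?_
    show _ ≤ (B + Z + 1) * μ ^ 2 * e i
    nlinarith only [h3, hB0, hZ0, mul_nonneg hB0 h3, mul_nonneg hZ0 h3]

end Recursion

/-! ### Second moments and martingale differences. -/

section Probability

theorem integrable_norm_sq {Ω E : Type*} {mΩ : MeasurableSpace Ω} {Pr : Measure Ω}
    [NormedAddCommGroup E] {Y : Ω → E} (hY : MemLp Y 2 Pr) :
    Integrable (fun ω => ‖Y ω‖ ^ 2) Pr := hY.integrable_norm_pow two_ne_zero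

theorem integral_le_add_of_forall_le {Ω : Type*} {mΩ : MeasurableSpace Ω} {Pr : Measure Ω}
    {f g k : Ω → ℝ} {A B : ℝ} (hf : Integrable f Pr)
    (hg : Integrable g Pr) (hk : Integrable k Pr) (h : ∀ ω, f ω ≤ A * g ω + B * k ω) :
    ∫ ω, f ω ∂Pr ≤ A * ∫ ω, g ω ∂Pr + B * ∫ ω, k ω ∂Pr := by
  rw [← integral_const_mul, ← integral_const_mul, ← integral_add (hg.const_mul _) (hk.const_mul _)]
  exact integral_mono hf ((hg.const_mul _).add (hk.const_mul _)) h

theorem integrable_inner_of_memLp_two {Ω E : Type*} {mΩ : MeasurableSpace Ω} {Pr : Measure Ω}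
    [NormedAddCommGroup E] [InnerProductSpace ℝ E] {Y S : Ω → E} (hY : MemLp Y 2 Pr)
    (hS : MemLp S 2 Pr) : Integrable (fun ω => inner ℝ (Y ω) (S ω)) Pr := by
  refine ((integrable_norm_sq hY).add (integrable_norm_sq hS)).mono' (hY.1.inner hS.1)
    (ae_of_all _ fun ω => (norm_inner_le_norm _ _).trans ?_)
  show ‖Y ω‖ * ‖S ω‖ ≤ ‖Y ω‖ ^ 2 + ‖S ω‖ ^ 2
  nlinarith [sq_nonneg (‖Y ω‖ - ‖S ω‖), sq_nonneg ‖Y ω‖, sq_nonneg ‖S ω‖]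

theorem integral_norm_sub_sq_le {Ω E : Type*} {mΩ : MeasurableSpace Ω} {Pr : Measure Ω}
    [NormedAddCommGroup E] [InnerProductSpace ℝ E] {Y S : Ω → E} (hY : MemLp Y 2 Pr)
    (hS : MemLp S 2 Pr) :
    ∫ ω, ‖Y ω - S ω‖ ^ 2 ∂Pr ≤ 2 * ∫ ω, ‖Y ω‖ ^ 2 ∂Pr + 2 * ∫ ω, ‖S ω‖ ^ 2 ∂Pr :=
  integral_le_add_of_forall_le (integrable_norm_sq (hY.sub hS)) (integrable_norm_sq hY)
    (integrable_norm_sq hS) fun _ => norm_sub_sq_le_two _ _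

variable {Ω : Type*} {m mΩ : MeasurableSpace Ω} {Pr : Measure Ω} [IsProbabilityMeasure Pr]

theorem integral_le_of_condExp_le (hm : m ≤ mΩ) {f g : Ω → ℝ} (hg : Integrable g Pr)
    (h : Pr[f | m] ≤ᵐ[Pr] g) : ∫ ω, f ω ∂Pr ≤ ∫ ω, g ω ∂Pr := by
  rw [← integral_condExp hm]
  exact integral_mono_ae integrable_condExp hg h

variable {E : Type*} [NormedAddCommGroup E] [InnerProductSpace ℝ E] [CompleteSpace E]

/-- The predictable factor comes out of the conditional expectation, so the cross terms in the
squared norms vanish. -/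
theorem integral_inner_eq_zero_of_condExp_eq_zero (hm : m ≤ mΩ) {Y S : Ω → E}
    (hY : StronglyMeasurable[m] Y) (hY2 : MemLp Y 2 Pr) (hS : MemLp S 2 Pr)
    (h0 : Pr[S | m] =ᵐ[Pr] 0) : ∫ ω, inner ℝ (Y ω) (S ω) ∂Pr = 0 := by
  have hi : Integrable (fun ω => innerSL ℝ (Y ω) (S ω)) Pr := integrable_inner_of_memLp_two hY2 hS
  have h1 := condExp_bilin_of_stronglyMeasurable_left (innerSL ℝ : E →L[ℝ] E →L[ℝ] ℝ) hY hi
    (hS.integrable one_le_two)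
  have h2 : Pr[fun ω => innerSL ℝ (Y ω) (S ω) | m] =ᵐ[Pr] 0 := by
    filter_upwards [h1, h0] with ω h1 h0
    rw [h1, h0]; simp
  have h3 := integral_condExp (μ := Pr) hm (f := fun ω => innerSL ℝ (Y ω) (S ω))
  rw [integral_congr_ae h2] at h3
  simpa using h3.symm

/-- Mean-square norm of a predictable vector plus a martingale difference. -/
theorem integral_norm_sub_smul_sq (hm : m ≤ mΩ) {Y S : Ω → E}
    (hY : StronglyMeasurable[m] Y) (hY2 : MemLp Y 2 Pr) (hS : MemLp S 2 Pr)
    (h0 : Pr[S | m] =ᵐ[Pr] 0) (c : ℝ) :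
    ∫ ω, ‖Y ω - c • S ω‖ ^ 2 ∂Pr = ∫ ω, ‖Y ω‖ ^ 2 ∂Pr + c ^ 2 * ∫ ω, ‖S ω‖ ^ 2 ∂Pr := by
  have h1 : ∀ ω, ‖Y ω - c • S ω‖ ^ 2
      = ‖Y ω‖ ^ 2 - 2 * c * inner ℝ (Y ω) (S ω) + c ^ 2 * ‖S ω‖ ^ 2 := fun ω => by
    rw [norm_sub_sq_real, norm_smul, real_inner_smul_right, mul_pow, Real.norm_eq_abs, sq_abs]
    ring
  have hi : Integrable (fun ω => inner ℝ (Y ω) (S ω)) Pr := integrable_inner_of_memLp_two hY2 hS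
  have hi' : Integrable (fun ω => ‖Y ω‖ ^ 2 - 2 * c * inner ℝ (Y ω) (S ω)) Pr :=
    (integrable_norm_sq hY2).sub (hi.const_mul _)
  simp_rw [h1]
  rw [integral_add hi' ((integrable_norm_sq hS).const_mul _), integral_sub (integrable_norm_sq hY2) (hi.const_mul _),
    integral_const_mul, integral_const_mul,
    integral_inner_eq_zero_of_condExp_eq_zero hm hY hY2 hS h0]
  ring

end Probability

/-! ### Moments of the gradient along random points. -/

section Lipschitz

variable {Ω E : Type*} {mΩ : MeasurableSpace Ω} {Pr : Measure Ω} [IsProbabilityMeasure Pr]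
  [NormedAddCommGroup E] {g : E → E} {δ : ℝ} {wo : E} {p : ENNReal}

theorem continuous_of_norm_sub_le (hlip : ∀ y z, ‖g y - g z‖ ≤ δ * ‖y - z‖) : Continuous g :=
  (LipschitzWith.of_dist_le_mul (K := δ.toNNReal) fun y z => by
    rw [dist_eq_norm, dist_eq_norm]
    exact (hlip y z).trans (mul_le_mul_of_nonneg_right (Real.le_coe_toNNReal δ)
      (norm_nonneg _))).continuous

theorem memLp_comp_of_norm_sub_le (hlip : ∀ y z, ‖g y - g z‖ ≤ δ * ‖y - z‖) (h0 : g wo = 0)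
    {Y : Ω → E} (hY : MemLp Y p Pr) : MemLp (fun ω => g (Y ω)) p Pr := by
  refine MemLp.of_le_mul (c := δ) (hY.sub (memLp_const wo))
    ((continuous_of_norm_sub_le hlip).comp_aestronglyMeasurable hY.1) (ae_of_all _ fun ω => ?_)
  have := hlip (Y ω) wo
  rwa [h0, sub_zero] at this

end Lipschitz

/-! ### One-step mean-square inequalities. -/

section MeanSquare

variable {Ω : Type*} {mΩ : MeasurableSpace Ω} {Pr : Measure Ω} [IsProbabilityMeasure Pr]
  {E : Type*} [NormedAddCommGroup E] [InnerProductSpace ℝ E] [CompleteSpace E]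

/-- One-step mean-square inequalities for `V' = V - μ (g Y + S)`, `D' = β D - (1 - β) μ (g Y + S)`
and `X' = X - μ (g X + R)`, where `Y = V - c D` and `S`, `R` are gradient noises. -/
theorem mean_square_step {m : MeasurableSpace Ω} (hm : m ≤ mΩ) {g : E → E} {wo : E}
    {ν δ μ β c k γ σ ξ : ℝ} (hν : 0 < ν) (hμ : 0 < μ) (hμ1 : μ ≤ 1)
    (hβ : 0 ≤ β) (hβ1 : β < 1) (hck : c ^ 2 ≤ k) (hξ : 0 ≤ ξ)
    (hmono : ∀ y z, ν * ‖y - z‖ ^ 2 ≤ inner ℝ (y - z) (g y - g z))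
    (hlip : ∀ y z, ‖g y - g z‖ ≤ δ * ‖y - z‖) (h0 : g wo = 0)
    {V D X Y S R : Ω → E} (hY : ∀ ω, Y ω = V ω - c • D ω)
    (hVm : StronglyMeasurable[m] V) (hDm : StronglyMeasurable[m] D)
    (hXm : StronglyMeasurable[m] X) (hV : MemLp V 2 Pr) (hD : MemLp D 2 Pr) (hX : MemLp X 2 Pr)
    (hS : MemLp S 2 Pr) (hR : MemLp R 2 Pr)
    (hS0 : Pr[S | m] =ᵐ[Pr] 0) (hR0 : Pr[R | m] =ᵐ[Pr] 0)
    (hS2 : ∫ ω, ‖S ω‖ ^ 2 ∂Pr ≤ γ ^ 2 * ∫ ω, ‖Y ω - wo‖ ^ 2 ∂Pr + σ ^ 2)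
    (hSR : ∫ ω, ‖S ω - R ω‖ ^ 2 ∂Pr ≤ ξ * ∫ ω, ‖Y ω - X ω‖ ^ 2 ∂Pr)
    {K : ℝ} (hK : K = (δ ^ 2 / ν + 2 * δ ^ 2 + 2 * γ ^ 2 + 2 * ξ) * (1 + k) + 1) :
    (∫ ω, ‖V ω - μ • (g (Y ω) + S ω) - wo‖ ^ 2 ∂Pr ≤
      (1 - μ * ν + K * μ ^ 2) * ∫ ω, ‖V ω - wo‖ ^ 2 ∂Pr + K * μ * ∫ ω, ‖D ω‖ ^ 2 ∂Pr
        + μ ^ 2 * σ ^ 2) ∧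
    (∫ ω, ‖β • D ω - ((1 - β) * μ) • (g (Y ω) + S ω)‖ ^ 2 ∂Pr ≤
      β * ∫ ω, ‖D ω‖ ^ 2 ∂Pr + K * μ ^ 2 * (∫ ω, ‖V ω - wo‖ ^ 2 ∂Pr + ∫ ω, ‖D ω‖ ^ 2 ∂Pr
        + σ ^ 2)) ∧
    (∫ ω, ‖V ω - μ • (g (Y ω) + S ω) - (X ω - μ • (g (X ω) + R ω))‖ ^ 2 ∂Pr ≤
      (1 - μ * ν + K * μ ^ 2) * ∫ ω, ‖V ω - X ω‖ ^ 2 ∂Pr + K * μ * ∫ ω, ‖D ω‖ ^ 2 ∂Pr) := by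
  have hYe : Y = fun ω => V ω - c • D ω := funext hY
  have hYm : StronglyMeasurable[m] Y := by rw [hYe]; exact hVm.sub (hDm.const_smul c)
  have hY2 : MemLp Y 2 Pr := by rw [hYe]; exact hV.sub (hD.const_smul c)
  have hgc := continuous_of_norm_sub_le hlip
  have hgYm : StronglyMeasurable[m] fun ω => g (Y ω) := hgc.comp_stronglyMeasurable hYm
  have hgXm : StronglyMeasurable[m] fun ω => g (X ω) := hgc.comp_stronglyMeasurable hXm
  have hgY : MemLp (fun ω => g (Y ω)) 2 Pr := memLp_comp_of_norm_sub_le hlip h0 hY2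
  have hgX : MemLp (fun ω => g (X ω)) 2 Pr := memLp_comp_of_norm_sub_le hlip h0 hX
  have hwo : MemLp (fun _ : Ω => wo) 2 Pr := memLp_const wo
  have hVwo : MemLp (fun ω => V ω - wo) 2 Pr := hV.sub hwo
  have hVX : MemLp (fun ω => V ω - X ω) 2 Pr := hV.sub hX
  have hYwo : MemLp (fun ω => Y ω - wo) 2 Pr := hY2.sub hwo
  set a := ∫ ω, ‖V ω - wo‖ ^ 2 ∂Pr with ha
  set b := ∫ ω, ‖D ω‖ ^ 2 ∂Pr with hb
  set z := ∫ ω, ‖V ω - X ω‖ ^ 2 ∂Pr with hz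
  have ha0 : 0 ≤ a := integral_nonneg fun ω => by positivity
  have hb0 : 0 ≤ b := integral_nonneg fun ω => by positivity
  have hz0 : 0 ≤ z := integral_nonneg fun ω => by positivity
  have hk0 : 0 ≤ k := (sq_nonneg c).trans hck
  have hδν : 0 ≤ δ ^ 2 / ν := by positivity
  have hμ2 : 0 ≤ μ ^ 2 := sq_nonneg μ
  have hμ2μ : μ ^ 2 ≤ μ := by nlinarith only [hμ, hμ1]
  have hcb : c ^ 2 * b ≤ k * b := mul_le_mul_of_nonneg_right hck hb0
  have hdist : ∀ (q : Ω → E), MemLp q 2 Pr → ∫ ω, ‖Y ω - q ω‖ ^ 2 ∂Pr ≤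
      2 * ∫ ω, ‖V ω - q ω‖ ^ 2 ∂Pr + 2 * (k * b) := by
    intro q hq
    have h1 : ∫ ω, ‖Y ω - q ω‖ ^ 2 ∂Pr ≤
        2 * ∫ ω, ‖V ω - q ω‖ ^ 2 ∂Pr + 2 * c ^ 2 * ∫ ω, ‖D ω‖ ^ 2 ∂Pr := by
      refine integral_le_add_of_forall_le (integrable_norm_sq (hY2.sub hq))
        (integrable_norm_sq (hV.sub hq)) (integrable_norm_sq hD) fun ω => ?_
      have h2 := norm_sub_sq_le_two (V ω - q ω) (c • D ω)
      rw [norm_smul, mul_pow, Real.norm_eq_abs, sq_abs] at h2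
      rw [hY, sub_right_comm]
      linarith
    linarith
  -- Used twice: `q = wo` gives contraction towards the minimizer, `q = X` towards the other method.
  have hstep : ∀ (q : Ω → E), MemLp q 2 Pr → MemLp (fun ω => g (q ω)) 2 Pr →
      ∫ ω, ‖(V ω - q ω) - μ • (g (Y ω) - g (q ω))‖ ^ 2 ∂Pr ≤
        (1 - μ * ν + 2 * μ ^ 2 * δ ^ 2) * ∫ ω, ‖V ω - q ω‖ ^ 2 ∂Pr
          + (δ ^ 2 / ν + 2 * δ ^ 2) * μ * (k * b) := by
    intro q hq hgq
    have h1 : ∫ ω, ‖(V ω - q ω) - μ • (g (Y ω) - g (q ω))‖ ^ 2 ∂Pr ≤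
        (1 - μ * ν + 2 * μ ^ 2 * δ ^ 2) * ∫ ω, ‖V ω - q ω‖ ^ 2 ∂Pr
          + (μ * δ ^ 2 / ν + 2 * μ ^ 2 * δ ^ 2) * c ^ 2 * ∫ ω, ‖D ω‖ ^ 2 ∂Pr := by
      refine integral_le_add_of_forall_le
        (integrable_norm_sq ((hV.sub hq).sub ((hgY.sub hgq).const_smul μ)))
        (integrable_norm_sq (hV.sub hq)) (integrable_norm_sq hD) fun ω => ?_
      have h2 := gradient_step_contraction hν hμ.le hmono hlip (V ω) (q ω) (Y ω)
      have h3 : ‖V ω - Y ω‖ ^ 2 = c ^ 2 * ‖D ω‖ ^ 2 := by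
        rw [hY, sub_sub_cancel, norm_smul, mul_pow, Real.norm_eq_abs, sq_abs]
      rw [h3, ← mul_assoc] at h2
      exact h2
    have h2 : (μ * δ ^ 2 / ν + 2 * μ ^ 2 * δ ^ 2) * (c ^ 2 * b) ≤
        (δ ^ 2 / ν + 2 * δ ^ 2) * μ * (k * b) := by
      have h3 : μ * δ ^ 2 / ν + 2 * μ ^ 2 * δ ^ 2 ≤ (δ ^ 2 / ν + 2 * δ ^ 2) * μ := by
        have := mul_le_mul_of_nonneg_right hμ2μ (sq_nonneg δ)
        rw [mul_div_assoc]
        linarith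
      gcongr
    linarith
  have hdwo := hdist _ hwo
  have hdX := hdist X hX
  have hS2' : ∫ ω, ‖S ω‖ ^ 2 ∂Pr ≤ γ ^ 2 * (2 * a + 2 * (k * b)) + σ ^ 2 :=
    hS2.trans (by gcongr)
  have hSR' : ∫ ω, ‖S ω - R ω‖ ^ 2 ∂Pr ≤ ξ * (2 * z + 2 * (k * b)) := hSR.trans (by gcongr)
  have hkb := mul_nonneg hk0 hb0
  refine ⟨?_, ?_, ?_⟩
  · have h1 := integral_norm_sub_smul_sq hm
      (Y := fun ω => (V ω - wo) - μ • (g (Y ω) - g wo)) (S := S)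
      ((hVm.sub stronglyMeasurable_const).sub
        ((hgYm.sub stronglyMeasurable_const).const_smul μ))
      (hVwo.sub ((hgY.sub (memLp_const (g wo))).const_smul μ)) hS hS0 μ
    have h2 : ∀ ω, V ω - μ • (g (Y ω) + S ω) - wo
        = (V ω - wo) - μ • (g (Y ω) - g wo) - μ • S ω := fun ω => by
      rw [h0, sub_zero, smul_add]; abel
    simp_rw [h2]
    rw [h1]
    have h3 := hstep _ hwo (memLp_const (g wo))
    have h4 := mul_le_mul_of_nonneg_left hS2' hμ2
    have h5 : μ ^ 2 * (γ ^ 2 * (k * b)) ≤ μ * (γ ^ 2 * (k * b)) := by gcongr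
    have h6 : (2 * δ ^ 2 + 2 * γ ^ 2) * (μ ^ 2 * a) ≤ K * (μ ^ 2 * a) := by
      gcongr
      rw [hK]
      nlinarith only [hδν, hξ, hk0, sq_nonneg γ, sq_nonneg δ, mul_nonneg hδν hk0,
        mul_nonneg hξ hk0, mul_nonneg (sq_nonneg γ) hk0, mul_nonneg (sq_nonneg δ) hk0]
    have h7 : (δ ^ 2 / ν + 2 * δ ^ 2 + 2 * γ ^ 2) * k * (μ * b) ≤ K * (μ * b) := by
      gcongr
      rw [hK]
      nlinarith only [hδν, hξ, hk0, sq_nonneg γ, sq_nonneg δ, mul_nonneg hξ hk0]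
    linarith only [h3, h4, h5, h6, h7]
  · have h1 := integral_norm_sub_smul_sq hm
      (Y := fun ω => β • D ω - ((1 - β) * μ) • g (Y ω)) (S := S)
      ((hDm.const_smul β).sub (hgYm.const_smul _))
      ((hD.const_smul β).sub (hgY.const_smul _)) hS hS0 ((1 - β) * μ)
    have h2 : ∀ ω, β • D ω - ((1 - β) * μ) • (g (Y ω) + S ω)
        = β • D ω - ((1 - β) * μ) • g (Y ω) - ((1 - β) * μ) • S ω := fun ω => by
      rw [smul_add]; abel
    simp_rw [h2]
    rw [h1]
    have hβ' : 0 < 1 - β := by linarith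
    have h3 : ∫ ω, ‖β • D ω - ((1 - β) * μ) • g (Y ω)‖ ^ 2 ∂Pr ≤
        β * b + μ ^ 2 * δ ^ 2 * ∫ ω, ‖Y ω - wo‖ ^ 2 ∂Pr := by
      refine integral_le_add_of_forall_le
        (integrable_norm_sq ((hD.const_smul β).sub (hgY.const_smul _)))
        (integrable_norm_sq hD) (integrable_norm_sq hYwo) fun ω => ?_
      refine (norm_smul_sub_sq_le hβ hβ1 _ _).trans ?_
      -- The square of the factor `1 - β` in the step outweighs the division by `1 - β`, so the
      -- constant does not grow as `β` nears `1`.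
      have h4 : ‖((1 - β) * μ) • g (Y ω)‖ ^ 2 / (1 - β) = (1 - β) * (μ ^ 2 * ‖g (Y ω)‖ ^ 2) := by
        rw [norm_smul, mul_pow, Real.norm_eq_abs, sq_abs]; field_simp
      have h5 : ‖g (Y ω)‖ ^ 2 ≤ (δ * ‖Y ω - wo‖) ^ 2 := by
        gcongr
        have := hlip (Y ω) wo
        rwa [h0, sub_zero] at this
      have h6 : (1 - β) * (μ ^ 2 * ‖g (Y ω)‖ ^ 2) ≤ 1 * (μ ^ 2 * (δ * ‖Y ω - wo‖) ^ 2) := by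
        gcongr; linarith
      rw [h4]
      linarith
    have h4 : ((1 - β) * μ) ^ 2 * ∫ ω, ‖S ω‖ ^ 2 ∂Pr ≤
        (1 * μ) ^ 2 * (γ ^ 2 * (2 * a + 2 * (k * b)) + σ ^ 2) := by
      gcongr
      linarith
    have h5 := mul_le_mul_of_nonneg_left hdwo (mul_nonneg hμ2 (sq_nonneg δ))
    have h6 : (2 * δ ^ 2 + 2 * γ ^ 2) * (μ ^ 2 * a) ≤ K * (μ ^ 2 * a) := by
      gcongr
      rw [hK]
      nlinarith only [hδν, hξ, hk0, sq_nonneg γ, sq_nonneg δ, mul_nonneg hδν hk0,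
        mul_nonneg hξ hk0, mul_nonneg (sq_nonneg γ) hk0, mul_nonneg (sq_nonneg δ) hk0]
    have h7 : (2 * δ ^ 2 + 2 * γ ^ 2) * k * (μ ^ 2 * b) ≤ K * (μ ^ 2 * b) := by
      gcongr
      rw [hK]
      nlinarith only [hδν, hξ, hk0, sq_nonneg γ, sq_nonneg δ, mul_nonneg hξ hk0,
        mul_nonneg hδν hk0]
    have h8 : 1 * (μ ^ 2 * σ ^ 2) ≤ K * (μ ^ 2 * σ ^ 2) := by
      gcongr
      rw [hK]
      have : 0 ≤ (δ ^ 2 / ν + 2 * δ ^ 2 + 2 * γ ^ 2 + 2 * ξ) * (1 + k) := by positivity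
      linarith
    linarith only [h3, h4, h5, h6, h7, h8]
  -- The noise difference is again a martingale difference, with variance bounded through `‖Y - X‖²`
  -- alone.
  · have hSR0 : Pr[fun ω => S ω - R ω | m] =ᵐ[Pr] 0 := by
      have h1 := condExp_sub (hS.integrable one_le_two) (hR.integrable one_le_two) m
      filter_upwards [h1, hS0, hR0] with ω h1 h2 h3
      have h4 : Pr[S - R | m] ω = 0 := by rw [h1, Pi.sub_apply, h2, h3]; simp
      exact h4
    have h1 := integral_norm_sub_smul_sq hm
      (Y := fun ω => (V ω - X ω) - μ • (g (Y ω) - g (X ω))) (S := fun ω => S ω - R ω)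
      ((hVm.sub hXm).sub ((hgYm.sub hgXm).const_smul μ))
      (hVX.sub ((hgY.sub hgX).const_smul μ)) (hS.sub hR) hSR0 μ
    have h2 : ∀ ω, V ω - μ • (g (Y ω) + S ω) - (X ω - μ • (g (X ω) + R ω))
        = (V ω - X ω) - μ • (g (Y ω) - g (X ω)) - μ • (S ω - R ω) := fun ω => by
      simp only [smul_add, smul_sub]; abel
    simp_rw [h2]
    rw [h1]
    have h3 := hstep _ hX hgX
    have h4 := mul_le_mul_of_nonneg_left hSR' hμ2
    have h5 : μ ^ 2 * (ξ * (k * b)) ≤ μ * (ξ * (k * b)) := by gcongr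
    have h6 : (2 * δ ^ 2 + 2 * ξ) * (μ ^ 2 * z) ≤ K * (μ ^ 2 * z) := by
      gcongr
      rw [hK]
      nlinarith only [hδν, hξ, hk0, sq_nonneg γ, sq_nonneg δ, mul_nonneg hδν hk0,
        mul_nonneg hξ hk0, mul_nonneg (sq_nonneg γ) hk0, mul_nonneg (sq_nonneg δ) hk0]
    have h7 : (δ ^ 2 / ν + 2 * δ ^ 2 + 2 * ξ) * k * (μ * b) ≤ K * (μ * b) := by
      gcongr
      rw [hK]
      nlinarith only [hδν, hξ, hk0, sq_nonneg γ, sq_nonneg δ, mul_nonneg (sq_nonneg γ) hk0]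
    linarith only [h3, h4, h5, h6, h7]

end MeanSquare

/-! ### A common increment recursion for heavy-ball and Nesterov. -/

section Iterates

variable {M : ℕ} {Θ : Type*}

/-- Both momentum methods have increments `D` with `D' = β D - μ_m ∇Q(ψ)`. -/
theorem momentumIter_sub_succ (Q : Vec M → Θ → ℝ) {μm β β₁ β₂ : ℝ} (w₀ : Vec M) (t : ℕ → Θ)
    (hβ : β₁ + β₂ = β) (hβ0 : β₁ * β₂ = 0) (i : ℕ) :
    momentumIter Q μm β₁ β₂ w₀ t (i + 2) - momentumIter Q μm β₁ β₂ w₀ t (i + 1) =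
      β • (momentumIter Q μm β₁ β₂ w₀ t (i + 1) - momentumIter Q μm β₁ β₂ w₀ t i)
        - μm • lossGrad Q (momentumExtrap Q μm β₁ β₂ w₀ t (i + 1)) (t (i + 1)) := by
  have h : β₂ • (momentumExtrap Q μm β₁ β₂ w₀ t (i + 1) - momentumExtrap Q μm β₁ β₂ w₀ t i)
      = β₂ • (momentumIter Q μm β₁ β₂ w₀ t (i + 1) - momentumIter Q μm β₁ β₂ w₀ t i) := by
    -- For heavy-ball, `ψ = w` at every index, including the initial one; for Nesterov, both sides
    -- vanish.
    rcases mul_eq_zero.1 hβ0 with h0 | h0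
    · have h1 : ∀ n, momentumExtrap Q μm β₁ β₂ w₀ t n = momentumIter Q μm β₁ β₂ w₀ t n := by
        rintro (_ | n)
        · rfl
        · rw [momentumExtrap_succ, h0, zero_smul, add_zero]
      rw [h1, h1]
    · rw [h0, zero_smul, zero_smul]
  rw [momentumIter_succ_succ, h, ← hβ, momentumExtrap_succ, add_smul]
  abel

end Iterates

/-! ### From the geometric bound to the stated form. -/

section Transient

/-- From a bound by `μ ^ 2 (ρ ^ i + σ ^ 2)` to the two-term bounds with explicit constants. -/
theorem le_of_le_geometric_add_noise {ν δ γ σ B μ β : ℝ} (hν : 0 < ν) (hδ : 0 < δ) (hB : 0 < B)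
    (hμν : μ * ν ≤ 2) (hβ : 0 ≤ β) (hβ1 : β < 1) {C : ℝ}
    (hC1 : B / δ ^ 2 ≤ C) (hC2 : σ ≠ 0 → B * ν ^ 2 / (δ ^ 2 * σ ^ 2) ≤ C) {i : ℕ} {y : ℝ}
    (hy : y ≤ B * μ ^ 2 * ((1 - μ * ν / 2) ^ (i + 1) + σ ^ 2)) :
    y ≤ C * ((δ ^ 2 + γ ^ 2) * (1 - μ * ν / 2) ^ (i + 1) / (1 - β) ^ 2 * μ ^ 2)
      + C * (δ ^ 2 * σ ^ 4 * μ ^ 2 / ((1 - β) * ν ^ 2)) := by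
  have hβ' : 0 < 1 - β := by linarith
  have hC : 0 ≤ C := le_trans (by positivity) hC1
  have hρi : 0 ≤ (1 - μ * ν / 2) ^ (i + 1) := pow_nonneg (by linarith) _
  rw [div_le_iff₀ (by positivity)] at hC1
  have h1 : B * (1 - μ * ν / 2) ^ (i + 1) ≤
      C * ((δ ^ 2 + γ ^ 2) * (1 - μ * ν / 2) ^ (i + 1) / (1 - β) ^ 2) := by
    have h2 : (δ ^ 2 + γ ^ 2) * (1 - μ * ν / 2) ^ (i + 1) ≤
        (δ ^ 2 + γ ^ 2) * (1 - μ * ν / 2) ^ (i + 1) / (1 - β) ^ 2 := by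
      rw [le_div_iff₀ (by positivity)]
      refine mul_le_of_le_one_right ?_ (pow_le_one₀ hβ'.le (by linarith))
      exact mul_nonneg (by positivity) hρi
    refine le_trans ?_ (mul_le_mul_of_nonneg_left h2 hC)
    rw [← mul_assoc]
    refine mul_le_mul_of_nonneg_right (hC1.trans ?_) hρi
    exact mul_le_mul_of_nonneg_left (le_add_of_nonneg_right (sq_nonneg γ)) hC
  have h2 : B * σ ^ 2 ≤ C * (δ ^ 2 * σ ^ 4 / ((1 - β) * ν ^ 2)) := by
    -- The target carries `σ ^ 4` against `σ ^ 2` here; for `σ ≠ 0` the missing factor is paid by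
    -- `C`, which may depend on `σ`.
    rcases eq_or_ne σ 0 with h0 | h0
    · simp [h0]
    have h3 := hC2 h0
    rw [div_le_iff₀ (by positivity)] at h3
    have h4 : C * (δ ^ 2 * σ ^ 4 / ν ^ 2) ≤ C * (δ ^ 2 * σ ^ 4 / ((1 - β) * ν ^ 2)) := by
      gcongr
      exact mul_le_of_le_one_left (by positivity) (by linarith)
    refine le_trans ?_ h4
    rw [← mul_div_assoc, le_div_iff₀ (by positivity)]
    have := mul_le_mul_of_nonneg_right h3 (sq_nonneg σ)
    linarith
  have h3 := mul_le_mul_of_nonneg_right h1 (sq_nonneg μ)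
  have h4 := mul_le_mul_of_nonneg_right h2 (sq_nonneg μ)
  have h5 : C * (δ ^ 2 * σ ^ 4 * μ ^ 2 / ((1 - β) * ν ^ 2))
      = C * (δ ^ 2 * σ ^ 4 / ((1 - β) * ν ^ 2)) * μ ^ 2 := by ring
  rw [h5]
  linarith

/-- Nonnegativity of `u` supplies the coboundedness that a real `limsup` needs. -/
theorem limsup_le_of_le_of_tendsto {u v : ℕ → ℝ} {l : ℝ} (hu : ∀ i, 0 ≤ u i)
    (huv : ∀ i, u i ≤ v i) (hv : Tendsto v atTop (nhds l)) : limsup u atTop ≤ l := by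
  rw [← hv.limsup_eq]
  exact limsup_le_limsup (Eventually.of_forall huv)
    (isCoboundedUnder_le_of_le atTop hu) hv.isBoundedUnder_le

end Transient

/-! ### Moments of the iterates and the mean-square distance. -/

section Main

theorem lossGrad_eq {M : ℕ} {Θ : Type*} [MeasurableSpace Θ] (Q : Vec M → Θ → ℝ) (P : Measure Θ)
    (v : Vec M) (t : Θ) : lossGrad Q v t = gradient (risk Q P) v + gradNoise Q P v t := by
  rw [gradNoise, add_sub_cancel]

variable {M : ℕ} {Θ Ω : Type*} [MeasurableSpace Θ] {mΩ : MeasurableSpace Ω}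

/-- All iterates have finite fourth moments. -/
theorem memLp_iterates {P : Measure Θ} {Q : Vec M → Θ → ℝ} {wo : Vec M} {Pr : Measure Ω}
    [IsProbabilityMeasure Pr] {θ : ℕ → Ω → Θ} {ℱ : Filtration ℕ mΩ} {w₀ : Ω → Vec M}
    {β₁ β₂ μ μm δ γ₄ σ₄ : ℝ} {w ψ x : ℕ → Ω → Vec M}
    (hlip : ∀ y z, ‖gradient (risk Q P) y - gradient (risk Q P) z‖ ≤ δ * ‖y - z‖)
    (h0 : gradient (risk Q P) wo = 0) (hw₀ : MemLp w₀ 4 Pr)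
    (hw : w = fun n ω => momentumIter Q μm β₁ β₂ (w₀ ω) (fun k => θ k ω) n)
    (hψ : ψ = fun n ω => momentumExtrap Q μm β₁ β₂ (w₀ ω) (fun k => θ k ω) n)
    (hx : x = fun n ω => sgd Q μ (w₀ ω) (fun k => θ k ω) n)
    (hwm : ∀ n, Measurable[ℱ n] (w n)) (hxm : ∀ n, Measurable[ℱ (n + 1)] (x n))
    (hN : NoiseFourth Q P wo Pr ℱ θ γ₄ σ₄) :
    (∀ n, PastVec Pr (ℱ n) (w n)) ∧ (∀ n, PastVec Pr (ℱ n) (ψ n)) ∧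
      ∀ n, PastVec Pr (ℱ (n + 1)) (x n) := by
  have hgrad : ∀ (k : ℕ) (v : Ω → Vec M), PastVec Pr (ℱ k) v →
      MemLp (fun ω => lossGrad Q (v ω) (θ k ω)) 4 Pr := fun k v hv => by
    simp_rw [lossGrad_eq Q P]
    exact (memLp_comp_of_norm_sub_le hlip h0 hv.2).add (hN.memLp k v hv)
  have hψm : ∀ n, Measurable[ℱ n] (ψ n) := by
    rintro (_ | n)
    · have : ψ 0 = w 0 := by rw [hψ, hw]; rfl
      rw [this]; exact hwm 0
    · have : ψ (n + 1) = fun ω => w (n + 1) ω + β₁ • (w (n + 1) ω - w n ω) := by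
        rw [hψ, hw]; rfl
      rw [this]
      have h1 : Measurable[ℱ (n + 1)] (w n) := (hwm n).mono (ℱ.mono n.le_succ) le_rfl
      exact (hwm (n + 1)).add (((hwm (n + 1)).sub h1).const_smul β₁)
  -- The recursion is of second order, so the induction carries two consecutive `w` and the `ψ`
  -- between them.
  have hwψ : ∀ n, MemLp (w n) 4 Pr ∧ MemLp (ψ n) 4 Pr ∧ MemLp (w (n + 1)) 4 Pr := by
    intro n
    induction n with
    | zero =>
      have e0 : w 0 = w₀ := by rw [hw]; rfl
      have e1 : ψ 0 = w₀ := by rw [hψ]; rfl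
      have e2 : w 1 = fun ω => w₀ ω - μm • lossGrad Q (w₀ ω) (θ 0 ω) := by rw [hw]; rfl
      refine ⟨e0 ▸ hw₀, e1 ▸ hw₀, ?_⟩
      rw [zero_add, e2]
      exact hw₀.sub ((hgrad 0 w₀ ⟨e0 ▸ hwm 0, hw₀⟩).const_smul μm)
    | succ n ih =>
      obtain ⟨i1, i2, i3⟩ := ih
      have e1 : ψ (n + 1) = fun ω => w (n + 1) ω + β₁ • (w (n + 1) ω - w n ω) := by
        rw [hψ, hw]; rfl
      have hψ1 : MemLp (ψ (n + 1)) 4 Pr := by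
        rw [e1]; exact i3.add ((i3.sub i1).const_smul β₁)
      have e2 : w (n + 2) = fun ω => ψ (n + 1) ω - μm • lossGrad Q (ψ (n + 1) ω) (θ (n + 1) ω)
          + β₂ • (ψ (n + 1) ω - ψ n ω) := by
        rw [hψ, hw]; rfl
      refine ⟨i3, hψ1, ?_⟩
      rw [e2]
      exact (hψ1.sub ((hgrad (n + 1) _ ⟨hψm _, hψ1⟩).const_smul μm)).add
        ((hψ1.sub i2).const_smul β₂)
  refine ⟨fun n => ⟨hwm n, (hwψ n).1⟩, fun n => ⟨hψm n, (hwψ n).2.1⟩, fun n => ⟨hxm n, ?_⟩⟩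
  induction n with
  | zero =>
    have e0 : x 0 = w₀ := by rw [hx]; rfl
    rw [e0]; exact hw₀
  | succ n ih =>
    have e1 : x (n + 1) = fun ω => x n ω - μ • lossGrad Q (x n ω) (θ (n + 1) ω) := by
      rw [hx]; rfl
    rw [e1]
    exact ih.sub ((hgrad (n + 1) _ ⟨hxm n, ih⟩).const_smul μ)

theorem integral_norm_sq_le_of_fourth {Pr : Measure Ω} [IsProbabilityMeasure Pr] {E : Type*}
    [NormedAddCommGroup E] {Y : Ω → E} (hY : MemLp Y 4 Pr) {m₀ : ℝ}
    (h : ∫ ω, ‖Y ω‖ ^ 4 ∂Pr ≤ m₀) : ∫ ω, ‖Y ω‖ ^ 2 ∂Pr ≤ 1 + m₀ := by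
  have h4 : Integrable (fun ω => ‖Y ω‖ ^ 4) Pr := by
    simpa using hY.integrable_norm_pow (p := 4) (by norm_num)
  have h2 : Integrable (fun ω => ‖Y ω‖ ^ 2) Pr :=
    integrable_norm_sq (hY.mono_exponent (by norm_num))
  calc ∫ ω, ‖Y ω‖ ^ 2 ∂Pr ≤ ∫ ω, (1 + ‖Y ω‖ ^ 4) ∂Pr := by
        refine integral_mono h2 ((integrable_const 1).add h4) fun ω => ?_
        show ‖Y ω‖ ^ 2 ≤ 1 + ‖Y ω‖ ^ 4
        nlinarith [sq_nonneg (‖Y ω‖ ^ 2 - 1), sq_nonneg (‖Y ω‖)]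
    _ = 1 + ∫ ω, ‖Y ω‖ ^ 4 ∂Pr := by
        rw [integral_add (integrable_const 1) h4]; simp
    _ ≤ _ := by linarith

end Main

/-- The mean-square distance between the momentum method and the method without momentum is
`O(μ ^ 2)`, up to a transient with ratio `1 - μ ν / 2` and proportional to `σ ^ 2` in the limit. -/
theorem exists_mean_square_distance_le (ν δ γ σ ξ ε m₀ : ℝ) (hν : 0 < ν) (hδ : 0 ≤ δ)
    (hε : 0 < ε) :
    ∃ B μ₀ : ℝ, 0 < B ∧ 0 < μ₀ ∧
      ∀ (M : ℕ) (Θ : Type u) [MeasurableSpace Θ] (P : Measure Θ) (Q : Vec M → Θ → ℝ)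
        (wo : Vec M)
        (Ω : Type v) (mΩ : MeasurableSpace Ω) (Pr : Measure Ω) [IsProbabilityMeasure Pr]
        (θ : ℕ → Ω → Θ) (ℱ : Filtration ℕ mΩ) (w₀ : Ω → Vec M)
        (β β₁ β₂ μ μm γ₄ σ₄ : ℝ) (w ψ x : ℕ → Ω → Vec M),
        (∀ v : Vec M, risk Q P wo ≤ risk Q P v) →
        RiskCondition (risk Q P) ν δ →
        0 ≤ β₁ → 0 ≤ β₂ → β₁ + β₂ = β → β₁ * β₂ = 0 → β ≤ 1 - ε →
        0 < μ → μ < μ₀ → μ = μm / (1 - β) →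
        (MemLp w₀ 4 Pr) → (∫ ω, ‖wo - w₀ ω‖ ^ 4 ∂Pr ≤ m₀) →
        (w = fun n ω => momentumIter Q μm β₁ β₂ (w₀ ω) (fun k => θ k ω) n) →
        (ψ = fun n ω => momentumExtrap Q μm β₁ β₂ (w₀ ω) (fun k => θ k ω) n) →
        (x = fun n ω => sgd Q μ (w₀ ω) (fun k => θ k ω) n) →
        (∀ n : ℕ, Measurable[ℱ n] (w n)) →
        (∀ n : ℕ, Measurable[ℱ (n + 1)] (x n)) →
        NoiseFourth Q P wo Pr ℱ θ γ₄ σ₄ →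
        NoiseSecond Q P wo Pr ℱ θ γ σ →
        NoiseLipschitz Q P Pr ℱ θ ψ x 2 ξ →
        ∀ i : ℕ, Integrable (fun ω => ‖w (i + 2) ω - x (i + 1) ω‖ ^ 2) Pr ∧
          ∫ ω, ‖w (i + 2) ω - x (i + 1) ω‖ ^ 2 ∂Pr ≤
            B * μ ^ 2 * ((1 - μ * ν / 2) ^ (i + 1) + σ ^ 2) := by
  -- The scalar recursion needs `ε ≤ 1`. Below, `k` bounds `(β/(1-β))²` uniformly in `β`, and
  -- absolute values stand in for the unknown signs of `ξ` and `m₀`.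
  set ε' := min ε 1 with hε'
  have hε'0 : 0 < ε' := by positivity
  set k := (1 / ε') ^ 2 with hk
  set K := (δ ^ 2 / ν + 2 * δ ^ 2 + 2 * γ ^ 2 + 2 * |ξ|) * (1 + k) + 1 with hK
  set G := (2 * δ ^ 2 + 2 * γ ^ 2) * (1 + |m₀|) + 2 * σ ^ 2 with hG
  obtain ⟨C, μ₀, hC, hμ₀, hrec⟩ := exists_bound_of_coupled_recursion (ν := ν) (ε := ε') (K := K)
    (A₀ := 2 * (1 + |m₀|) + 2 * G) hν hε'0 (min_le_right _ _) (by positivity) (by positivity)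
  refine ⟨(2 + 2 * k) * C, min μ₀ 1, by positivity, by positivity, ?_⟩
  intro M Θ _ P Q wo Ω mΩ Pr _ θ ℱ w₀ β β₁ β₂ μ μm γ₄ σ₄ w ψ x hmin hJ hβ₁ hβ₂ hβ hββ hβε hμ hμlt
    hμm hw₀ hm₀ hw hψ hx hwm hxm hN4 hN2 hNL
  obtain ⟨hμlt, hμ1⟩ := lt_min_iff.1 hμlt
  have hβ0 : 0 ≤ β := by linarith
  have hβ1 : β < 1 := by linarith
  have hβε' : β ≤ 1 - ε' := by linarith [min_le_left ε 1]
  have h1β : 0 < 1 - β := by linarith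
  have hμm' : μm = (1 - β) * μ := by rw [hμm]; field_simp
  set g := gradient (risk Q P) with hg
  have hlip : ∀ y z, ‖g y - g z‖ ≤ δ * ‖y - z‖ := hJ.norm_gradient_sub_le hν.le hδ
  have hmono : ∀ y z, ν * ‖y - z‖ ^ 2 ≤ inner ℝ (y - z) (g y - g z) := hJ.strongly_monotone
  have h0 : g wo = 0 := gradient_eq_zero_of_forall_le hmin
  obtain ⟨hW, hΨ, hX⟩ := memLp_iterates hlip h0 hw₀ hw hψ hx hwm hxm hN4
  have h24 : ∀ {f : Ω → Vec M}, MemLp f 4 Pr → MemLp f 2 Pr := fun hf =>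
    hf.mono_exponent (by norm_num)
  set c' := β / (1 - β) with hc'
  set c := c' - β₁ with hc
  have hc'0 : 0 ≤ c' := by positivity
  have hc'ε : c' ≤ 1 / ε' := by
    rw [hc']
    gcongr <;> linarith
  have hβc' : β ≤ c' := by
    rw [hc', le_div_iff₀ h1β]; nlinarith
  have hc'k : c' ^ 2 ≤ k := by rw [hk]; gcongr
  have hck : c ^ 2 ≤ k := by
    have : 0 ≤ c := by linarith
    have : c ≤ c' := by linarith
    exact le_trans (by gcongr) hc'k
  set D : ℕ → Ω → Vec M := fun i ω => w (i + 1) ω - w i ω with hD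
  set V : ℕ → Ω → Vec M := fun i ω => w (i + 1) ω + c' • D i ω with hV
  set S : ℕ → Ω → Vec M := fun i ω => gradNoise Q P (ψ (i + 1) ω) (θ (i + 1) ω) with hS
  set R : ℕ → Ω → Vec M := fun i ω => gradNoise Q P (x i ω) (θ (i + 1) ω) with hR
  have hDrec : ∀ i ω, D (i + 1) ω = β • D i ω - ((1 - β) * μ) • (g (ψ (i + 1) ω) + S i ω) := by
    intro i ω
    have := momentumIter_sub_succ Q (μm := μm) (w₀ ω) (fun k => θ k ω) hβ hββ i
    rw [lossGrad_eq Q P, hμm'] at this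
    simp only [hD, hS, hw, hψ, hμm']
    exact this
  have hVrec : ∀ i ω, V (i + 1) ω = V i ω - μ • (g (ψ (i + 1) ω) + S i ω) := by
    intro i ω
    have h1 : V (i + 1) ω = w (i + 1) ω + (1 + c') • D (i + 1) ω := by
      simp only [hV, hD, add_smul, one_smul]; abel
    -- Since `1 + c' = 1/(1-β)`, the momentum in `D` reproduces `c' • D` and the step `(1-β)μ`
    -- becomes `μ`.
    have h2 : (1 + c') * β = c' := by rw [hc']; field_simp; ring
    have h3 : (1 + c') * ((1 - β) * μ) = μ := by rw [hc']; field_simp; ring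
    rw [h1, hDrec, smul_sub, smul_smul, smul_smul, h2, h3, ← add_sub_assoc]
  have hXrec : ∀ i ω, x (i + 1) ω = x i ω - μ • (g (x i ω) + R i ω) := by
    intro i ω
    rw [hR, hg, ← lossGrad_eq Q P, hx]; rfl
  have hY : ∀ i ω, ψ (i + 1) ω = V i ω - c • D i ω := by
    intro i ω
    have h1 : ψ (i + 1) ω = w (i + 1) ω + β₁ • D i ω := by rw [hψ, hD, hw]; rfl
    rw [h1, hc, sub_smul]; simp only [hV]; abel
  have hwm' : ∀ i, StronglyMeasurable[ℱ (i + 1)] (w i) := fun i =>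
    ((hwm i).mono (ℱ.mono i.le_succ) le_rfl).stronglyMeasurable
  have hDm : ∀ i, StronglyMeasurable[ℱ (i + 1)] (D i) := fun i =>
    (hwm (i + 1)).stronglyMeasurable.sub (hwm' i)
  have hVm : ∀ i, StronglyMeasurable[ℱ (i + 1)] (V i) := fun i =>
    (hwm (i + 1)).stronglyMeasurable.add ((hDm i).const_smul c')
  have hD2 : ∀ i, MemLp (D i) 2 Pr := fun i => (h24 (hW (i + 1)).2).sub (h24 (hW i).2)
  have hV2 : ∀ i, MemLp (V i) 2 Pr := fun i => (h24 (hW (i + 1)).2).add ((hD2 i).const_smul c')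
  have hX2 : ∀ i, MemLp (x i) 2 Pr := fun i => h24 (hX i).2
  have hΨ2 : ∀ i, MemLp (ψ i) 2 Pr := fun i => h24 (hΨ i).2
  have hwo : MemLp (fun _ : Ω => wo) 2 Pr := memLp_const wo
  have hnoise : ∀ (n : ℕ) (v : Ω → Vec M), PastVec Pr (ℱ n) v →
      ∫ ω, ‖gradNoise Q P (v ω) (θ n ω)‖ ^ 2 ∂Pr ≤
        γ ^ 2 * ∫ ω, ‖v ω - wo‖ ^ 2 ∂Pr + σ ^ 2 := by
    intro n v hv
    have hi : Integrable (fun ω => ‖v ω - wo‖ ^ 2) Pr :=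
      integrable_norm_sq ((h24 hv.2).sub hwo)
    have h1 := hN2 n v hv
    simp_rw [norm_sub_rev wo] at h1
    refine (integral_le_of_condExp_le (ℱ.le n)
      ((hi.const_mul (γ ^ 2)).add (integrable_const (σ ^ 2))) h1).trans (le_of_eq ?_)
    simp only [Pi.add_apply]
    rw [integral_add (hi.const_mul _) (integrable_const _), integral_const_mul]
    simp
  have hSR : ∀ i, ∫ ω, ‖S i ω - R i ω‖ ^ 2 ∂Pr ≤ |ξ| * ∫ ω, ‖ψ (i + 1) ω - x i ω‖ ^ 2 ∂Pr := by
    intro i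
    have hi : Integrable (fun ω => ‖ψ (i + 1) ω - x i ω‖ ^ 2) Pr :=
      integrable_norm_sq ((hΨ2 (i + 1)).sub (hX2 i))
    refine (integral_le_of_condExp_le (ℱ.le (i + 1)) (hi.const_mul ξ) (hNL i)).trans ?_
    rw [integral_const_mul]
    exact mul_le_mul_of_nonneg_right (le_abs_self ξ) (integral_nonneg fun ω => by positivity)
  have hstep := fun i => mean_square_step (Pr := Pr) (ℱ.le (i + 1)) hν hμ hμ1.le hβ0 hβ1 hck
    (abs_nonneg ξ) hmono hlip h0 (hY i) (hVm i) (hDm i) (hX i).1.stronglyMeasurable (hV2 i) (hD2 i)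
    (hX2 i) (h24 (hN4.memLp (i + 1) _ (hΨ (i + 1)))) (h24 (hN4.memLp (i + 1) _ (hX i)))
    (hN4.mean_zero (i + 1) _ (hΨ (i + 1))) (hN4.mean_zero (i + 1) _ (hX i))
    (hnoise (i + 1) _ (hΨ (i + 1))) (hSR i) hK
  have hm : ∫ ω, ‖w₀ ω - wo‖ ^ 2 ∂Pr ≤ 1 + |m₀| := by
    refine integral_norm_sq_le_of_fourth (hw₀.sub (memLp_const wo)) ?_
    simp only [Pi.sub_apply]
    simp_rw [norm_sub_rev wo] at hm₀
    exact hm₀.trans (le_abs_self _)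
  have hw0 : PastVec Pr (ℱ 0) w₀ := by
    have : w 0 = w₀ := by rw [hw]; rfl
    rw [← this]; exact hW 0
  set L : Ω → Vec M := fun ω => g (w₀ ω) + gradNoise Q P (w₀ ω) (θ 0 ω) with hL
  have hg2 : MemLp (fun ω => g (w₀ ω)) 2 Pr := memLp_comp_of_norm_sub_le hlip h0 (h24 hw₀)
  have hs2 : MemLp (fun ω => gradNoise Q P (w₀ ω) (θ 0 ω)) 2 Pr := h24 (hN4.memLp 0 w₀ hw0)
  have hL2 : MemLp L 2 Pr := hg2.add hs2
  have hw0wo : MemLp (fun ω => w₀ ω - wo) 2 Pr := (h24 hw₀).sub hwo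
  have hLG : ∫ ω, ‖L ω‖ ^ 2 ∂Pr ≤ G := by
    have h1 : ∫ ω, ‖L ω‖ ^ 2 ∂Pr ≤ 2 * δ ^ 2 * ∫ ω, ‖w₀ ω - wo‖ ^ 2 ∂Pr +
        2 * ∫ ω, ‖gradNoise Q P (w₀ ω) (θ 0 ω)‖ ^ 2 ∂Pr := by
      refine integral_le_add_of_forall_le (integrable_norm_sq hL2) (integrable_norm_sq hw0wo)
        (integrable_norm_sq hs2) fun ω => (norm_add_sq_le_two _ _).trans ?_
      have h2 : ‖g (w₀ ω)‖ ^ 2 ≤ (δ * ‖w₀ ω - wo‖) ^ 2 := by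
        gcongr
        have := hlip (w₀ ω) wo
        rwa [h0, sub_zero] at this
      linarith
    have h2 := hnoise 0 w₀ hw0
    have h3 := mul_le_mul_of_nonneg_left hm (by positivity : 0 ≤ 2 * δ ^ 2 + 2 * γ ^ 2)
    rw [hG]
    linarith
  have hG0 : 0 ≤ G := by positivity
  have hD0 : ∀ ω, D 0 ω = -(((1 - β) * μ) • L ω) := by
    intro ω
    have h1 : D 0 ω = (w₀ ω - μm • lossGrad Q (w₀ ω) (θ 0 ω)) - w₀ ω := by rw [hD, hw]; rfl
    rw [h1, lossGrad_eq Q P, hμm', sub_sub_cancel_left]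
  -- The initial step, rescaled by `1 + c'`, is a full step `μ` from `w₀ = x 0`; thus `V 0 - x 0` is
  -- `O(μ²)` in mean square.
  have hV0 : ∀ ω, V 0 ω = w₀ ω - μ • L ω := by
    intro ω
    have h1 : w 1 ω = w₀ ω + D 0 ω := by
      have : w 0 ω = w₀ ω := by rw [hw]; rfl
      simp only [hD, zero_add, this, add_sub_cancel]
    have h2 : V 0 ω = w₀ ω + (1 + c') • D 0 ω := by
      have : V 0 ω = w 1 ω + c' • D 0 ω := rfl
      rw [this, h1, add_smul, one_smul, add_assoc]
    have h3 : (1 + c') * ((1 - β) * μ) = μ := by rw [hc']; field_simp; ring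
    rw [h2, hD0, smul_neg, smul_smul, h3, sub_eq_add_neg]
  have hx0 : x 0 = w₀ := by rw [hx]; rfl
  have hμ2 : μ ^ 2 ≤ 1 := pow_le_one₀ hμ.le hμ1.le
  have hLμ : ∀ r : ℝ, ∫ ω, ‖r • L ω‖ ^ 2 ∂Pr = r ^ 2 * ∫ ω, ‖L ω‖ ^ 2 ∂Pr := by
    intro r
    rw [← integral_const_mul]
    congr 1; ext ω
    rw [norm_smul, mul_pow, Real.norm_eq_abs, sq_abs]
  have hL0 : 0 ≤ ∫ ω, ‖L ω‖ ^ 2 ∂Pr := integral_nonneg fun ω => by positivity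
  have hbase := hrec μ (σ ^ 2) (fun i => ∫ ω, ‖V i ω - wo‖ ^ 2 ∂Pr) (fun i => ∫ ω, ‖D i ω‖ ^ 2 ∂Pr)
    (fun i => ∫ ω, ‖V i ω - x i ω‖ ^ 2 ∂Pr) hμ hμlt (sq_nonneg σ)
    (fun i => integral_nonneg fun ω => by positivity)
    (fun i => integral_nonneg fun ω => by positivity)
    (fun i => integral_nonneg fun ω => by positivity) ?_ ?_ ?_ ?_ ?_ ?_
  · intro i
    -- `w (i + 2)` is recovered from `V (i + 1)` and `D (i + 1)`, whence the exponent `i + 1`.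
    have hi := hbase (i + 1)
    have hwx : ∀ ω, w (i + 2) ω - x (i + 1) ω
        = (V (i + 1) ω - x (i + 1) ω) - c' • D (i + 1) ω := fun ω => by
      simp only [hV]; abel
    have hVX := (hV2 (i + 1)).sub (hX2 (i + 1))
    refine ⟨integrable_norm_sq ((h24 (hW (i + 2)).2).sub (hX2 (i + 1))), ?_⟩
    simp_rw [hwx]
    have h1 : ∫ ω, ‖(V (i + 1) ω - x (i + 1) ω) - c' • D (i + 1) ω‖ ^ 2 ∂Pr ≤
        2 * ∫ ω, ‖V (i + 1) ω - x (i + 1) ω‖ ^ 2 ∂Pr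
          + 2 * k * ∫ ω, ‖D (i + 1) ω‖ ^ 2 ∂Pr := by
      refine integral_le_add_of_forall_le (integrable_norm_sq (hVX.sub ((hD2 _).const_smul c')))
        (integrable_norm_sq hVX) (integrable_norm_sq (hD2 _)) fun ω => ?_
      refine (norm_sub_sq_le_two _ _).trans ?_
      rw [norm_smul, mul_pow, Real.norm_eq_abs, sq_abs]
      have := mul_le_mul_of_nonneg_right hc'k (sq_nonneg ‖D (i + 1) ω‖)
      linarith
    have h2 := mul_le_mul_of_nonneg_left hi.1 (by positivity : 0 ≤ 2 * k)
    linarith [hi.2]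
  · have h1 := integral_norm_sub_sq_le hw0wo (hL2.const_smul μ)
    simp only [Pi.smul_apply] at h1
    rw [hLμ] at h1
    have h2 : ∀ ω, V 0 ω - wo = (w₀ ω - wo) - μ • L ω := fun ω => by rw [hV0]; abel
    simp only [h2]
    have h3 : μ ^ 2 * ∫ ω, ‖L ω‖ ^ 2 ∂Pr ≤ 1 * G := by gcongr
    linarith
  · simp only [hD0, norm_neg]
    rw [hLμ]
    have h1 : ((1 - β) * μ) ^ 2 ≤ (1 * μ) ^ 2 := by
      gcongr
      linarith
    calc ((1 - β) * μ) ^ 2 * ∫ ω, ‖L ω‖ ^ 2 ∂Pr ≤ (1 * μ) ^ 2 * G := by gcongr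
      _ ≤ (2 * (1 + |m₀|) + 2 * G) * μ ^ 2 := by
        rw [one_mul, mul_comm]
        gcongr
        linarith [abs_nonneg m₀]
  · have h2 : ∀ ω, V 0 ω - x 0 ω = -(μ • L ω) := fun ω => by rw [hV0, hx0]; abel
    simp only [h2, norm_neg]
    rw [hLμ]
    calc μ ^ 2 * ∫ ω, ‖L ω‖ ^ 2 ∂Pr ≤ μ ^ 2 * G := by gcongr
      _ ≤ (2 * (1 + |m₀|) + 2 * G) * μ ^ 2 := by
        rw [mul_comm]
        gcongr
        linarith [abs_nonneg m₀]
  · intro i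
    simp only [hVrec]
    exact (hstep i).1
  · intro i
    simp only [hDrec]
    refine (hstep i).2.1.trans ?_
    gcongr
  · intro i
    simp only [hVrec, hXrec]
    exact (hstep i).2.2

end MomentumSGD

theorem theorem4
    (ν δ κ γ σ γ₄ σ₄ ξ₁ ξ₂ ε m₀ : ℝ)
    (hν : 0 < ν) (hνδ : ν ≤ δ) (hκ : 0 ≤ κ) (hγ : 0 ≤ γ) (hσ : 0 ≤ σ)
    (hγ₄ : 0 ≤ γ₄) (hσ₄ : 0 ≤ σ₄) (hε : 0 < ε) :
    ∃ C μ₀ : ℝ, 0 < C ∧ 0 < μ₀ ∧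
      ∀ (M : ℕ) (Θ : Type u) [MeasurableSpace Θ] (P : Measure Θ) (Q : Vec M → Θ → ℝ)
        (wo : Vec M)
        (Ω : Type v) (mΩ : MeasurableSpace Ω) (Pr : Measure Ω) [IsProbabilityMeasure Pr]
        (θ : ℕ → Ω → Θ) (ℱ : Filtration ℕ mΩ) (w₀ : Ω → Vec M)
        (β β₁ β₂ μ μm : ℝ) (w ψ x : ℕ → Ω → Vec M),
        -- the loss, the samples, and the minimizer of the risk
        (∀ t : Θ, Differentiable ℝ (fun v => Q v t)) →
        (∀ v : Vec M, Integrable (Q v) P) →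
        (∀ k : ℕ, HasLaw (θ k) P Pr) →
        (∀ v : Vec M, risk Q P wo ≤ risk Q P v) →
        -- conditions on the risk
        RiskCondition (risk Q P) ν δ →
        HessianLipschitz (risk Q P) κ →
        -- momentum parameters and step-sizes
        0 ≤ β₁ → 0 ≤ β₂ → β₁ + β₂ = β → β₁ * β₂ = 0 → β ≤ 1 - ε →
        0 < μ → μ < μ₀ → μ = μm / (1 - β) →
        -- both recursions, from the same initial state (`w n = w_{n-2}`, `ψ n = ψ_{n-2}`,
        -- `x n = x_{n-1}`)
        (MemLp w₀ 4 Pr) → (∫ ω, ‖wo - w₀ ω‖ ^ 4 ∂Pr ≤ m₀) →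
        (w = fun n ω => momentumIter Q μm β₁ β₂ (w₀ ω) (fun k => θ k ω) n) →
        (ψ = fun n ω => momentumExtrap Q μm β₁ β₂ (w₀ ω) (fun k => θ k ω) n) →
        (x = fun n ω => sgd Q μ (w₀ ω) (fun k => θ k ω) n) →
        (∀ n : ℕ, Measurable[ℱ n] (w n)) →
        (∀ n : ℕ, Measurable[ℱ (n + 1)] (x n)) →
        -- conditions on the gradient noise
        NoiseFourth Q P wo Pr ℱ θ γ₄ σ₄ →
        NoiseSecond Q P wo Pr ℱ θ γ σ →
        NoiseLipschitz Q P Pr ℱ θ ψ x 2 ξ₁ →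
        NoiseLipschitz Q P Pr ℱ θ ψ x 4 ξ₂ →
        -- conclusions, for `ρ₁ = 1 - μν/2` and `τ₂ = √(1 - μν/4)`
        (1 - μ * ν / 2 ∈ Set.Ioo (0 : ℝ) 1 ∧ √(1 - μ * ν / 4) ∈ Set.Ioo (0 : ℝ) 1) ∧
        (∀ i : ℕ, Integrable (fun ω => ‖w (i + 2) ω - x (i + 1) ω‖ ^ 2) Pr) ∧
        (∀ i : ℕ,
          ∫ ω, ‖w (i + 2) ω - x (i + 1) ω‖ ^ 2 ∂Pr ≤
            C * (δ ^ 2 * σ ^ 2 * (i : ℝ) ^ 2 * √(1 - μ * ν / 4) ^ (i + 1) * μ ^ (3 / 2 : ℝ)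
                    / ((1 - β) * ν ^ (5 / 2 : ℝ))
                + ((δ ^ 2 + γ ^ 2) * (1 - μ * ν / 2) ^ (i + 1) / (1 - β) ^ 2
                    + δ ^ 2 * σ ^ 4 / ((1 - β) * ν ^ 2)) * μ ^ 2)) ∧
        (∀ i : ℕ,
          ∫ ω, ‖w (i + 2) ω - x (i + 1) ω‖ ^ 2 ∂Pr ≤ C * μ ^ (3 / 2 : ℝ)) ∧
        limsup (fun i : ℕ => ∫ ω, ‖w (i + 2) ω - x (i + 1) ω‖ ^ 2 ∂Pr) atTop ≤
          C * (δ ^ 2 * σ ^ 4 * μ ^ 2 / ((1 - β) * ν ^ 2)) ∧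
        limsup (fun i : ℕ => ∫ ω, ‖w (i + 2) ω - x (i + 1) ω‖ ^ 2 ∂Pr) atTop ≤
          C * μ ^ 2 := by
  have hδ : 0 < δ := hν.trans_le hνδ
  obtain ⟨B, μ₀, hB, hμ₀, hmain⟩ :=
    exists_mean_square_distance_le.{u, v} ν δ γ σ ξ₁ ε m₀ hν hδ.le hε
  -- One summand each for the transient, for trading `σ ^ 2` against `σ ^ 4`, and for the uniform `μ
  -- ^ 2` bound. The middle one is `0` when `σ = 0`, by the convention for division.
  set C := B / δ ^ 2 + B * ν ^ 2 / (δ ^ 2 * σ ^ 2) + B * (1 + σ ^ 2) with hC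
  have hCa : 0 < B / δ ^ 2 := by positivity
  have hCb : 0 ≤ B * ν ^ 2 / (δ ^ 2 * σ ^ 2) := by positivity
  have hCc : 0 < B * (1 + σ ^ 2) := by positivity
  have hC0 : 0 < C := by linarith
  refine ⟨C, min μ₀ (min 1 (1 / ν)), hC0, by positivity, ?_⟩
  intro M Θ _ P Q wo Ω mΩ Pr _ θ ℱ w₀ β β₁ β₂ μ μm w ψ x _ _ _ hmin hJ _ hβ₁ hβ₂ hβ hββ hβε hμ hμlt
    hμm hw₀ hm₀ hw hψ hx hwm hxm hN4 hN2 hNL _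
  simp only [lt_min_iff] at hμlt
  obtain ⟨hμlt, hμ1, hμν⟩ := hμlt
  rw [lt_div_iff₀ hν] at hμν
  have hμν0 : 0 < μ * ν := by positivity
  have hβ0 : 0 ≤ β := by linarith
  have hβ1 : β < 1 := by linarith
  have h1β : 0 < 1 - β := by linarith
  have hd := hmain M Θ P Q wo Ω mΩ Pr θ ℱ w₀ β β₁ β₂ μ μm γ₄ σ₄ w ψ x hmin hJ hβ₁ hβ₂ hβ hββ hβε hμ
    hμlt hμm hw₀ hm₀ hw hψ hx hwm hxm hN4 hN2 hNL
  have hρ0 : 0 < 1 - μ * ν / 2 := by linarith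
  have hρ1 : 1 - μ * ν / 2 < 1 := by linarith
  have hle := fun i : ℕ => le_of_le_geometric_add_noise (γ := γ) hν hδ hB (by linarith) hβ0 hβ1
    (show B / δ ^ 2 ≤ C by linarith) (fun _ => show B * ν ^ 2 / (δ ^ 2 * σ ^ 2) ≤ C by linarith)
    (hd i).2
  have hnn : ∀ i : ℕ, 0 ≤ ∫ ω, ‖w (i + 2) ω - x (i + 1) ω‖ ^ 2 ∂Pr := fun i =>
    integral_nonneg fun ω => by positivity
  have hsq : ∀ i : ℕ, ∫ ω, ‖w (i + 2) ω - x (i + 1) ω‖ ^ 2 ∂Pr ≤ C * μ ^ 2 := fun i => by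
    refine (hd i).2.trans ?_
    have h1 : (1 - μ * ν / 2) ^ (i + 1) ≤ 1 := pow_le_one₀ hρ0.le hρ1.le
    calc B * μ ^ 2 * ((1 - μ * ν / 2) ^ (i + 1) + σ ^ 2) ≤ B * μ ^ 2 * (1 + σ ^ 2) := by gcongr
      _ = B * (1 + σ ^ 2) * μ ^ 2 := by ring
      _ ≤ C * μ ^ 2 := by gcongr; linarith
  refine ⟨⟨⟨hρ0, hρ1⟩, ?_, ?_⟩, fun i => (hd i).1, fun i => ?_, fun i => ?_, ?_, ?_⟩
  · exact Real.sqrt_pos.2 (by linarith)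
  · rw [Real.sqrt_lt' one_pos]; linarith
  · refine (hle i).trans ?_
    -- The `μ ^ (3 / 2)` term is nonnegative and only enlarges the right-hand side.
    have h1 : 0 ≤ C * (δ ^ 2 * σ ^ 2 * (i : ℝ) ^ 2 * √(1 - μ * ν / 4) ^ (i + 1) * μ ^ (3 / 2 : ℝ)
        / ((1 - β) * ν ^ (5 / 2 : ℝ))) := by positivity
    have h2 : δ ^ 2 * σ ^ 4 * μ ^ 2 / ((1 - β) * ν ^ 2)
        = δ ^ 2 * σ ^ 4 / ((1 - β) * ν ^ 2) * μ ^ 2 := by ring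
    rw [h2]
    linarith
  · refine (hsq i).trans (mul_le_mul_of_nonneg_left ?_ hC0.le)
    rw [← Real.rpow_natCast μ 2]
    exact Real.rpow_le_rpow_of_exponent_ge hμ hμ1.le (by norm_num)
  · refine limsup_le_of_le_of_tendsto hnn hle ?_
    have h1 := (tendsto_add_atTop_iff_nat 1).2 (tendsto_pow_atTop_nhds_zero_of_lt_one hρ0.le hρ1)
    have h2 := ((((h1.const_mul (δ ^ 2 + γ ^ 2)).div_const ((1 - β) ^ 2)).mul_const
      (μ ^ 2)).const_mul C).add_const (C * (δ ^ 2 * σ ^ 4 * μ ^ 2 / ((1 - β) * ν ^ 2)))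
    simpa using h2
  · exact limsup_le_of_le_of_tendsto hnn hsq tendsto_const_nhds
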